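/- Throughout, $\otimes$ is the minimal (spatial) tensor product of $C^*$-algebras, $M(B)$ is the multiplier algebra of $B$, a $*$-homomorphism $f:A\to M(B)$ is non-degenerate if $f(A)B$ spans a dense subspace of $B$, and non-degenerate homomorphisms are tacitly extended to $M(A)\to M(B)$. A locally compact quantum group (LCQG) $\mathbb G$ consists of a $C^*$-algebra $C=C_0(\mathbb G)$ and a non-degenerate $*$-homomorphism $\Delta:C\to M(C\otimes C)$ such that $(\Delta\otimes\mathrm{id})\Delta=(\mathrm{id}\otimes\Delta)\Delta$; the sets $\{(\omega\otimes\mathrm{id})\Delta(a)\mid \omega\in C^*,a\in C\}$ and $\{(\mathrm{id}\otimes\omega)\Delta(a)\mid \omega\in C^*,a\in C\}$ are contained in $C$ and span dense subspaces of $C$; and there are a faithful left-invariant approximate KMS weight and a right-invariant approximate KMS weight on $C$ (in the sense of Kustermans and Vaes: proper weights, i.e. non-zero, densely defined and lower semicontinuous, whose $W^*$-lift to the von Neumann algebra generated by the GNS representation is faithful). An action of $\mathbb G$ on a $C^*$-algebra $A$ is a non-degenerate $*$-homomorphism $\rho:A\to M(C_0(\mathbb G)\otimes A)$ such that $(\Delta\otimes\mathrm{id})\rho=(\mathrm{id}\otimes\rho)\rho$,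 all elements $\rho(a)(c\otimes 1)$ and $(c\otimes 1)\rho(a)$ ($a\in A$, $c\in C_0(\mathbb G)$) lie in $C_0(\mathbb G)\otimes A$, and the elements $\rho(a)(c\otimes 1)$ span a dense subspace of $C_0(\mathbb G)\otimes A$. Let $\mathcal C^*_1$ be the category of unital $C^*$-algebras (the zero algebra included) and unital $*$-homomorphisms, and let $\mathcal C^{*\mathbb G}_1$ be the category of unital $C^*$-algebras $A$ equipped with an action $\rho_A$ of $\mathbb G$, whose morphisms are the unital $*$-homomorphisms $f:A\to B$ that are equivariant: $(\mathrm{id}\otimes f)\rho_A=\rho_B f$. **Proposition.** For every LCQG $\mathbb G$, the forgetful functor $\mathcal C^{*\mathbb G}_1\to\mathcal C^*_1$ creates finite products (including the empty one). That is, for every finite family $(A_i,\rho_i)$ of objects of $\mathcal C^{*\mathbb G}_1$ and every product cone $(A\to A_i)_i$ of the underlying algebras in $\mathcal C^*_1$, there is a cone over $(A_i,\rho_i)_i$ in $\mathcal C^{*\mathbb G}_1$ whose image is isomorphic to the given cone; it is unique up to isomorphism, and it is a product of the $(A_i,\rho_i)$ in $\mathcal C^{*\mathbb G}_1$. -/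

import Mathlib

open scoped TensorProduct MultiplierAlgebra

universe u

set_option linter.unusedSectionVars false

namespace LCQG
noncomputable section
open UniformSpace Filter Topology

section Hilbert
variable {H K : Type u} [NormedAddCommGroup H] [InnerProductSpace ℂ H]
  [NormedAddCommGroup K] [InnerProductSpace ℂ K]

variable (H K) in
/-- The algebraic tensor product of two Hilbert spaces, with its inner product. It is not completed:
bounded operators on it and on its completion are the same thing, with the same norm. -/
def HTensor : Type u := H ⊗[ℂ] K

instance : NormedAddCommGroup (HTensor H K) := inferInstanceAs (NormedAddCommGroup (H ⊗[ℂ] K))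
instance : InnerProductSpace ℂ (HTensor H K) := inferInstanceAs (InnerProductSpace ℂ (H ⊗[ℂ] K))

def HTensor.tmul (h : H) (k : K) : HTensor H K := h ⊗ₜ[ℂ] k

theorem HTensor.induction {p : HTensor H K → Prop} (x : HTensor H K) (h0 : p 0)
    (ht : ∀ h k, p (tmul h k)) (ha : ∀ x y, p x → p y → p (x + y)) : p x :=
  TensorProduct.induction_on (motive := p) x h0 ht ha

theorem HTensor.inner_tmul (h h' : H) (k k' : K) :
    inner ℂ (tmul h k) (tmul h' k') = inner ℂ h h' * inner ℂ k k' :=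
  TensorProduct.inner_tmul ..

/-- The operator `S ⊗ T` on `H ⊗ K`, as a bilinear function of `S` and `T`. -/
def HTensor.mapₗ : (H →L[ℂ] H) →ₗ[ℂ] (K →L[ℂ] K) →ₗ[ℂ] (HTensor H K →L[ℂ] HTensor H K) :=
  LinearMap.mk₂ ℂ (fun S T ↦ (TensorProduct.mapL S T : H ⊗[ℂ] K →L[ℂ] H ⊗[ℂ] K))
    (fun _ _ _ ↦ TensorProduct.mapL_add_left ..) (fun _ _ _ ↦ TensorProduct.mapL_smul_left ..)
    (fun _ _ _ ↦ TensorProduct.mapL_add_right ..) (fun _ _ _ ↦ TensorProduct.mapL_smul_right ..)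

theorem HTensor.norm_map_le (S : H →L[ℂ] H) (T : K →L[ℂ] K) : ‖mapₗ S T‖ ≤ ‖S‖ * ‖T‖ :=
  TensorProduct.norm_mapL_le ..

theorem HTensor.map_tmul (S : H →L[ℂ] H) (T : K →L[ℂ] K) (h : H) (k : K) :
    mapₗ S T (tmul h k) = tmul (S h) (T k) := rfl

theorem HTensor.map_mul (S S' : H →L[ℂ] H) (T T' : K →L[ℂ] K) :
    mapₗ (S * S') (T * T') = mapₗ S T * mapₗ S' T' := TensorProduct.mapL_mul ..

end Hilbert

/-- A representation of a C*-algebra by bounded operators on a Hilbert space. -/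
structure HilbertRep (A : Type u) [NonUnitalCStarAlgebra A] where
  space : Type u
  [normed : NormedAddCommGroup space]
  [innerProduct : InnerProductSpace ℂ space]
  [complete : CompleteSpace space]
  hom : A →⋆ₙₐ[ℂ] (space →L[ℂ] space)

attribute [instance] HilbertRep.normed HilbertRep.innerProduct HilbertRep.complete

section AlgTensor
variable (A B : Type u) [NonUnitalCStarAlgebra A] [NonUnitalCStarAlgebra B]

/-- The algebraic tensor product `A ⊙ B`, to be normed by the spatial norm. -/
def AlgTensor : Type u := A ⊗[ℂ] B

instance : NonUnitalRing (AlgTensor A B) := inferInstanceAs (NonUnitalRing (A ⊗[ℂ] B))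
instance : Module ℂ (AlgTensor A B) := inferInstanceAs (Module ℂ (A ⊗[ℂ] B))
instance : IsScalarTower ℂ (AlgTensor A B) (AlgTensor A B) :=
  inferInstanceAs (IsScalarTower ℂ (A ⊗[ℂ] B) (A ⊗[ℂ] B))
instance : SMulCommClass ℂ (AlgTensor A B) (AlgTensor A B) :=
  inferInstanceAs (SMulCommClass ℂ (A ⊗[ℂ] B) (A ⊗[ℂ] B))
instance : StarAddMonoid (AlgTensor A B) := inferInstanceAs (StarAddMonoid (A ⊗[ℂ] B))
instance : StarModule ℂ (AlgTensor A B) := inferInstanceAs (StarModule ℂ (A ⊗[ℂ] B))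

variable {A B}

/-- An elementary tensor in the algebraic tensor product. -/
def AlgTensor.tmul (a : A) (b : B) : AlgTensor A B := a ⊗ₜ[ℂ] b

theorem AlgTensor.induction {p : AlgTensor A B → Prop} (x : AlgTensor A B) (h0 : p 0)
    (ht : ∀ a b, p (tmul a b)) (ha : ∀ x y, p x → p y → p (x + y)) : p x :=
  TensorProduct.induction_on (motive := p) x h0 ht ha

theorem AlgTensor.tmul_mul (a a' : A) (b b' : B) :
    (tmul a b * tmul a' b' : AlgTensor A B) = tmul (a * a') (b * b') :=
  Algebra.TensorProduct.tmul_mul_tmul a a' b b'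

theorem AlgTensor.star_tmul (a : A) (b : B) :
    star (tmul a b : AlgTensor A B) = tmul (star a) (star b) := rfl

instance : StarRing (AlgTensor A B) where
  star_add := star_add
  star_mul x y := by
    induction x using AlgTensor.induction with
    | h0 => simp
    | ha x x' h h' => rw [add_mul, star_add, star_add, mul_add, h, h']
    | ht a b =>
      induction y using AlgTensor.induction with
      | h0 => simp
      | ha x x' h h' => rw [mul_add, star_add, star_add, add_mul, h, h']
      | ht a' b' => simp [AlgTensor.tmul_mul, AlgTensor.star_tmul]

/-- The operator `(π ⊗ σ)(x)` on the tensor product of the two Hilbert spaces. -/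
def repTensor (π : HilbertRep A) (σ : HilbertRep B) :
    AlgTensor A B →ₗ[ℂ] (HTensor π.space σ.space →L[ℂ] HTensor π.space σ.space) :=
  (TensorProduct.lift (HTensor.mapₗ.compl₁₂ (LinearMapClass.linearMap π.hom)
    (LinearMapClass.linearMap σ.hom)) :
    A ⊗[ℂ] B →ₗ[ℂ] _)

variable (π : HilbertRep A) (σ : HilbertRep B)

theorem repTensor_tmul (a : A) (b : B) :
    repTensor π σ (.tmul a b) = HTensor.mapₗ (π.hom a) (σ.hom b) := rfl

theorem repTensor_mul (x y : AlgTensor A B) :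
    repTensor π σ (x * y) = repTensor π σ x * repTensor π σ y := by
  induction x using AlgTensor.induction with
  | h0 => simp
  | ha x x' h h' => rw [add_mul, map_add, map_add, add_mul, h, h']
  | ht a b =>
    induction y using AlgTensor.induction with
    | h0 => simp
    | ha x x' h h' => rw [mul_add, map_add, map_add, mul_add, h, h']
    | ht a' b' =>
      simp only [AlgTensor.tmul_mul, repTensor_tmul, map_mul, HTensor.map_mul]

theorem repTensor_star (x : AlgTensor A B) (v w : HTensor π.space σ.space) :
    inner ℂ (repTensor π σ (star x) v) w = inner ℂ v (repTensor π σ x w) := by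
  induction x using AlgTensor.induction with
  | h0 => simp
  | ha x x' h h' =>
    rw [star_add, map_add, map_add, add_apply, add_apply,
      inner_add_left, inner_add_right, h, h']
  | ht a b =>
    rw [AlgTensor.star_tmul, repTensor_tmul, repTensor_tmul]
    induction v using HTensor.induction with
    | h0 => simp
    | ha x y h h' => rw [map_add, inner_add_left, inner_add_left, h, h']
    | ht h k =>
      induction w using HTensor.induction with
      | h0 => simp
      | ha x y h h' => rw [map_add, inner_add_right, inner_add_right, h, h']
      | ht h' k' =>
        simp [map_star, ContinuousLinearMap.star_eq_adjoint, HTensor.map_tmul, HTensor.inner_tmul,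
          ContinuousLinearMap.adjoint_inner_left]

theorem norm_repTensor_tmul_le (a : A) (b : B) : ‖repTensor π σ (.tmul a b)‖ ≤ ‖a‖ * ‖b‖ := by
  refine (HTensor.norm_map_le _ _).trans ?_
  gcongr
  · exact NonUnitalStarAlgHom.norm_apply_le π.hom a
  · exact NonUnitalStarAlgHom.norm_apply_le σ.hom b

theorem repTensor_bdd (x : AlgTensor A B) :
    BddAbove (Set.range fun p : HilbertRep A × HilbertRep B ↦ ‖repTensor p.1 p.2 x‖) := by
  suffices h : ∃ C, ∀ p : HilbertRep A × HilbertRep B, ‖repTensor p.1 p.2 x‖ ≤ C by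
    obtain ⟨C, h⟩ := h
    exact ⟨C, by rintro _ ⟨p, rfl⟩; exact h p⟩
  induction x using AlgTensor.induction with
  | h0 => exact ⟨0, fun p ↦ by simp⟩
  | ha x y h h' =>
    obtain ⟨C, h⟩ := h
    obtain ⟨C', h'⟩ := h'
    exact ⟨C + C', fun p ↦ by
      rw [map_add]; exact (norm_add_le _ _).trans (add_le_add (h p) (h' p))⟩
  | ht a b => exact ⟨‖a‖ * ‖b‖, fun p ↦ norm_repTensor_tmul_le ..⟩

/-- The spatial (minimal) norm on the algebraic tensor product:
`‖x‖ = sup ‖(π ⊗ σ)(x)‖` over all pairs of representations. -/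
instance : Norm (AlgTensor A B) where
  norm x := ⨆ p : HilbertRep A × HilbertRep B, ‖repTensor p.1 p.2 x‖

theorem norm_repTensor_le (x : AlgTensor A B) : ‖repTensor π σ x‖ ≤ ‖x‖ :=
  le_ciSup (repTensor_bdd x) (π, σ)

theorem AlgTensor.norm_le {x : AlgTensor A B} {C : ℝ} (hC : 0 ≤ C)
    (h : ∀ (π : HilbertRep A) (σ : HilbertRep B), ‖repTensor π σ x‖ ≤ C) : ‖x‖ ≤ C :=
  Real.iSup_le (fun p ↦ h p.1 p.2) hC

theorem AlgTensor.norm_nonneg' (x : AlgTensor A B) : 0 ≤ ‖x‖ :=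
  Real.iSup_nonneg fun _ ↦ norm_nonneg _

theorem AlgTensor.norm_smul' (c : ℂ) (x : AlgTensor A B) : ‖c • x‖ = ‖c‖ * ‖x‖ := by
  change (⨆ p : HilbertRep A × HilbertRep B, ‖repTensor p.1 p.2 (c • x)‖) = ‖c‖ * ⨆ _, _
  simp only [map_smul, norm_smul, Real.mul_iSup_of_nonneg (norm_nonneg c)]

instance : SeminormedAddCommGroup (AlgTensor A B) :=
  SeminormedAddCommGroup.ofCore (𝕜 := ℂ)
    { norm_nonneg := AlgTensor.norm_nonneg'
      norm_smul := AlgTensor.norm_smul'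
      norm_triangle := fun x y ↦ AlgTensor.norm_le
        (add_nonneg (AlgTensor.norm_nonneg' x) (AlgTensor.norm_nonneg' y)) fun π σ ↦ by
          rw [map_add]
          exact (norm_add_le _ _).trans
            (add_le_add (norm_repTensor_le π σ x) (norm_repTensor_le π σ y)) }

instance : NonUnitalSeminormedRing (AlgTensor A B) where
  __ : SeminormedAddCommGroup (AlgTensor A B) := inferInstance
  __ : NonUnitalRing (AlgTensor A B) := inferInstance
  norm_mul_le x y := AlgTensor.norm_le
    (mul_nonneg (AlgTensor.norm_nonneg' x) (AlgTensor.norm_nonneg' y)) fun π σ ↦ by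
      rw [repTensor_mul]
      exact (norm_mul_le _ _).trans (mul_le_mul (norm_repTensor_le π σ x)
        (norm_repTensor_le π σ y) (norm_nonneg _) (AlgTensor.norm_nonneg' x))

instance : NormedSpace ℂ (AlgTensor A B) where
  norm_smul_le c x := (AlgTensor.norm_smul' c x).le

theorem AlgTensor.norm_mul_self_le (x : AlgTensor A B) : ‖x‖ * ‖x‖ ≤ ‖star x * x‖ := by
  have h : ‖x‖ ≤ √‖star x * x‖ := AlgTensor.norm_le (Real.sqrt_nonneg _) fun π σ ↦ by
    refine ContinuousLinearMap.opNorm_le_bound _ (Real.sqrt_nonneg _) fun v ↦ ?_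
    have h1 : ‖repTensor π σ x v‖ ^ 2 ≤ ‖star x * x‖ * ‖v‖ ^ 2 := by
      rw [← inner_self_eq_norm_sq (𝕜 := ℂ), ← repTensor_star, ← mul_apply_eq_comp,
        ← repTensor_mul, sq, ← mul_assoc]
      refine (RCLike.re_le_norm _).trans ((norm_inner_le_norm _ _).trans ?_)
      gcongr
      exact (ContinuousLinearMap.le_opNorm _ _).trans
        (mul_le_mul_of_nonneg_right (norm_repTensor_le π σ _) (norm_nonneg _))
    rw [← Real.sqrt_sq (norm_nonneg v), ← Real.sqrt_mul (norm_nonneg _)]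
    exact Real.le_sqrt_of_sq_le h1
  calc ‖x‖ * ‖x‖ ≤ √‖star x * x‖ * √‖star x * x‖ := by gcongr
    _ = _ := Real.mul_self_sqrt (norm_nonneg _)

instance : NormedStarGroup (AlgTensor A B) where
  norm_star_le x := by
    have h : ‖star x‖ * ‖star x‖ ≤ ‖x‖ * ‖star x‖ := by
      simpa using (AlgTensor.norm_mul_self_le (star x)).trans (norm_mul_le _ _)
    rcases (norm_nonneg (star x)).eq_or_lt with h0 | h0
    · rw [← h0]; exact norm_nonneg x
    · exact le_of_mul_le_mul_right h h0

end AlgTensor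

section Completion
variable {X Y : Type u} [NonUnitalSeminormedRing X] [StarRing X] [NormedSpace ℂ X]
  [IsScalarTower ℂ X X] [SMulCommClass ℂ X X] [StarModule ℂ X] [NormedStarGroup X]
  [NormedAddCommGroup Y] [NormedSpace ℂ Y] [CompleteSpace Y] {e : X →ₗᵢ[ℂ] Y} (he : DenseRange e)

variable (e) in
/-- Multiplication on the completion `Y` of `X` along `e`: first the left factor is in `X`. -/
def mulLeft (x : X) : Y →L[ℂ] Y :=
  ContinuousLinearMap.extend (e.toContinuousLinearMap ∘L ContinuousLinearMap.mul ℂ X x)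
    e.toContinuousLinearMap

theorem mulLeft_apply (he : DenseRange e) (x y : X) : mulLeft e x (e y) = e (x * y) :=
  ContinuousLinearMap.extend_eq _ he e.isometry.isUniformInducing y

/-- `mulLeft` as a bounded bilinear map. -/
def mulLeftL : X →L[ℂ] Y →L[ℂ] Y :=
  LinearMap.mkContinuous
    { toFun := mulLeft e
      map_add' := fun x x' ↦ ContinuousLinearMap.ext fun y ↦ by
        induction y using he.induction_on with
        | hp => exact isClosed_eq (by fun_prop) (by fun_prop)
        | ih y => simp only [add_apply, mulLeft_apply he, add_mul, map_add]
      map_smul' := fun c x ↦ ContinuousLinearMap.ext fun y ↦ by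
        induction y using he.induction_on with
        | hp => exact isClosed_eq (by fun_prop) (by fun_prop)
        | ih y =>
          simp only [RingHom.id_apply, smul_apply, mulLeft_apply he, smul_mul_assoc, map_smul] }
    1 fun x ↦ by
      rw [one_mul]
      refine ContinuousLinearMap.opNorm_le_bound _ (norm_nonneg _) fun y ↦ ?_
      induction y using he.induction_on with
      | hp => exact isClosed_le (by fun_prop) (by fun_prop)
      | ih y =>
        change ‖mulLeft e x (e y)‖ ≤ _
        rw [mulLeft_apply he, e.norm_map, e.norm_map]
        exact norm_mul_le x y

/-- Multiplication on the completion `Y` of `X` along `e`. -/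
def mulL : Y →L[ℂ] Y →L[ℂ] Y := (mulLeftL he).extend e.toContinuousLinearMap

theorem mulL_apply (x y : X) : mulL he (e x) (e y) = e (x * y) := by
  have := (mulLeftL he).extend_eq (e := e.toContinuousLinearMap) he e.isometry.isUniformInducing x
  exact (congrArg (· (e y)) this).trans (mulLeft_apply he x y)

/-- The involution on the completion `Y` of `X` along `e`. -/
def starC : Y → Y := (e.isometry.isUniformInducing.isDenseInducing he).extend (e ∘ star)

theorem starC_continuous : Continuous (starC he) :=
  (uniformContinuous_uniformly_extend e.isometry.isUniformInducing he
    (e.isometry.uniformContinuous.comp star_isometry.uniformContinuous)).continuous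

theorem starC_apply (x : X) : starC he (e x) = e (star x) :=
  uniformly_extend_of_ind e.isometry.isUniformInducing he
    (e.isometry.uniformContinuous.comp star_isometry.uniformContinuous) x

/-- The completion of a normed *-algebra with a C*-seminorm is a C*-algebra. -/
abbrev cstarCompletion (hX : ∀ x : X, ‖x‖ * ‖x‖ ≤ ‖star x * x‖) : NonUnitalCStarAlgebra Y :=
  have hm : Continuous fun z : Y × Y ↦ mulL he z.1 z.2 :=
    ((mulL he).continuous.comp continuous_fst).clm_apply continuous_snd
  have hm' {f g : Y × Y → Y} (hf : Continuous f) (hg : Continuous g) :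
      Continuous fun z ↦ mulL he (f z) (g z) := hm.comp (hf.prodMk hg)
  have hs := starC_continuous he
  { ‹NormedAddCommGroup Y›, ‹NormedSpace ℂ Y›, ‹CompleteSpace Y› with
    mul x y := mulL he x y
    left_distrib x y z := map_add (mulL he x) y z
    right_distrib x y z := by change mulL he (x + y) z = mulL he x z + mulL he y z; simp
    zero_mul x := by change mulL he 0 x = 0; simp
    mul_zero x := map_zero (mulL he x)
    mul_assoc x y z := by
      change mulL he (mulL he x y) z = mulL he x (mulL he y z)
      induction x, y using he.induction_on₂ with
      | hp => exact isClosed_eq (hm' hm continuous_const) (hm' (by fun_prop) (by fun_prop))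
      | h x y =>
        induction z using he.induction_on with
        | hp => exact isClosed_eq (by fun_prop) (by fun_prop)
        | ih z => simp only [mulL_apply, mul_assoc]
    norm_mul_le x y := by
      change ‖mulL he x y‖ ≤ ‖x‖ * ‖y‖
      induction x, y using he.induction_on₂ with
      | hp => exact isClosed_le hm.norm (by fun_prop)
      | h x y => simp only [mulL_apply, e.norm_map]; exact norm_mul_le x y
    star := starC he
    star_involutive x := by
      induction x using he.induction_on with
      | hp => exact isClosed_eq (by fun_prop) (by fun_prop)
      | ih x => simp only [starC_apply, star_star]
    star_mul x y := by
      change starC he (mulL he x y) = mulL he (starC he y) (starC he x)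
      induction x, y using he.induction_on₂ with
      | hp => exact isClosed_eq (by fun_prop) (hm' (by fun_prop) (by fun_prop))
      | h x y => simp only [mulL_apply, starC_apply, star_mul]
    star_add x y := by
      change starC he (x + y) = starC he x + starC he y
      induction x, y using he.induction_on₂ with
      | hp => exact isClosed_eq (by fun_prop) (by fun_prop)
      | h x y => simp only [← map_add, starC_apply, star_add]
    norm_mul_self_le x := by
      change ‖x‖ * ‖x‖ ≤ ‖mulL he (starC he x) x‖
      induction x using he.induction_on with
      | hp => exact isClosed_le (by fun_prop) (by fun_prop)
      | ih x => simp only [mulL_apply, starC_apply, e.norm_map]; exact hX x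
    smul_assoc c x y := by change mulL he (c • x) y = c • mulL he x y; simp
    smul_comm c x y := (map_smul (mulL he x) c y).symm
    star_smul c x := by
      change starC he (c • x) = star c • starC he x
      induction x using he.induction_on with
      | hp => exact isClosed_eq (by fun_prop) (by fun_prop)
      | ih x => simp only [← map_smul, starC_apply, star_smul] }

end Completion

section Extend
variable {X Y E : Type u} [NonUnitalSeminormedRing X] [StarRing X] [NormedSpace ℂ X]
  [NonUnitalCStarAlgebra Y] [NonUnitalCStarAlgebra E] {e : X →ₗᵢ[ℂ] Y} (he : DenseRange e)
  (hmul : ∀ x y, e (x * y) = e x * e y) (hstar : ∀ x, e (star x) = star (e x))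
  (f : X →⋆ₙₐ[ℂ] E) (hf : ∀ x, ‖f x‖ ≤ ‖x‖)

variable (e) in
/-- The bounded linear extension of `f`. -/
def extendL : Y →L[ℂ] E := ContinuousLinearMap.extend
  ((LinearMapClass.linearMap f).mkContinuous 1 fun x ↦ by rw [one_mul]; exact hf x)
  e.toContinuousLinearMap

theorem extendL_apply (he : DenseRange e) (x : X) : extendL e f hf (e x) = f x :=
  ContinuousLinearMap.extend_eq _ he e.isometry.isUniformInducing x

/-- A contractive homomorphism into a C*-algebra extends to the completion. -/
def extendHom : Y →⋆ₙₐ[ℂ] E where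
  toFun := extendL e f hf
  map_smul' := map_smul _
  map_zero' := map_zero _
  map_add' := map_add _
  map_mul' x y := by
    induction x, y using he.induction_on₂ with
    | hp => exact isClosed_eq (by fun_prop) (by fun_prop)
    | h x y => simp only [← hmul, extendL_apply f hf he, map_mul]
  map_star' x := by
    induction x using he.induction_on with
    | hp => exact isClosed_eq (by fun_prop) (by fun_prop)
    | ih x => simp only [← hstar, extendL_apply f hf he, map_star]

theorem extendHom_apply (x : X) : extendHom he hmul hstar f hf (e x) = f x :=
  extendL_apply f hf he x

end Extend

section Spatial
variable (A B : Type u) [NonUnitalCStarAlgebra A] [NonUnitalCStarAlgebra B]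

/-- The spatial (minimal) tensor product of two C*-algebras: the completion of the algebraic tensor
product in the spatial norm. -/
def SpatialTensor : Type u := Completion (AlgTensor A B)

infixl:70 " ⊗ₘ " => SpatialTensor

theorem denseRange_toCompl :
    DenseRange (Completion.toComplₗᵢ : AlgTensor A B →ₗᵢ[ℂ] Completion (AlgTensor A B)) :=
  Completion.denseRange_coe

instance : NonUnitalCStarAlgebra (A ⊗ₘ B) :=
  cstarCompletion (Y := Completion (AlgTensor A B)) (denseRange_toCompl A B)
    AlgTensor.norm_mul_self_le

variable {A B}

/-- The canonical map from the algebraic to the spatial tensor product. -/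
def ofAlg : AlgTensor A B →ₗᵢ[ℂ] A ⊗ₘ B :=
  (Completion.toComplₗᵢ : AlgTensor A B →ₗᵢ[ℂ] Completion (AlgTensor A B))

theorem denseRange_ofAlg : DenseRange (ofAlg : AlgTensor A B → A ⊗ₘ B) := denseRange_toCompl A B

theorem ofAlg_mul (x y : AlgTensor A B) : ofAlg (x * y) = ofAlg x * ofAlg y :=
  (mulL_apply (denseRange_toCompl A B) x y).symm

theorem ofAlg_star (x : AlgTensor A B) : ofAlg (star x) = star (ofAlg x) :=
  (starC_apply (denseRange_toCompl A B) x).symm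

/-- The elementary tensor `a ⊗ b`. -/
def tmul (a : A) (b : B) : A ⊗ₘ B := ofAlg (.tmul a b)

theorem tmul_mul (a a' : A) (b b' : B) : tmul a b * tmul a' b' = tmul (a * a') (b * b') := by
  rw [tmul, tmul, ← ofAlg_mul, AlgTensor.tmul_mul, tmul]

theorem star_tmul (a : A) (b : B) : star (tmul a b) = tmul (star a) (star b) := by
  rw [tmul, ← ofAlg_star, AlgTensor.star_tmul, tmul]

/-- A closed additive property of elements of `A ⊗ B` can be checked on elementary tensors. -/
theorem SpatialTensor.induction {p : A ⊗ₘ B → Prop} (x : A ⊗ₘ B) (hc : IsClosed {x | p x})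
    (h0 : p 0) (ht : ∀ a b, p (tmul a b)) (ha : ∀ x y, p x → p y → p (x + y)) : p x := by
  induction x using denseRange_ofAlg.induction_on with
  | hp => exact hc
  | ih x =>
    induction x using AlgTensor.induction with
    | h0 => rwa [map_zero]
    | ht a b => exact ht a b
    | ha x y h h' => rw [map_add]; exact ha _ _ h h'

theorem continuous_hom {E F : Type u} [NonUnitalCStarAlgebra E] [NonUnitalCStarAlgebra F]
    (f : E →⋆ₙₐ[ℂ] F) : Continuous f :=
  AddMonoidHomClass.continuous_of_bound f 1 fun x ↦ by
    rw [one_mul]; exact NonUnitalStarAlgHom.norm_apply_le f x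

section Map
variable {A' B' : Type u} [NonUnitalCStarAlgebra A'] [NonUnitalCStarAlgebra B']

/-- The homomorphism `f ⊗ g` on algebraic tensor products. -/
def AlgTensor.map (f : A →⋆ₙₐ[ℂ] A') (g : B →⋆ₙₐ[ℂ] B') :
    AlgTensor A B →⋆ₙₐ[ℂ] AlgTensor A' B' :=
  let F : AlgTensor A B →ₗ[ℂ] AlgTensor A' B' :=
    (TensorProduct.map (LinearMapClass.linearMap f) (LinearMapClass.linearMap g) :
      A ⊗[ℂ] B →ₗ[ℂ] A' ⊗[ℂ] B')
  have hF (a b) : F (tmul a b) = tmul (f a) (g b) := TensorProduct.map_tmul ..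
  { toFun := F
    map_smul' := map_smul F
    map_zero' := map_zero F
    map_add' := map_add F
    map_mul' := fun x y ↦ by
      induction x using AlgTensor.induction with
      | h0 => simp
      | ha x x' h h' => rw [add_mul, map_add, map_add, add_mul, h, h']
      | ht a b =>
        induction y using AlgTensor.induction with
        | h0 => simp
        | ha x x' h h' => rw [mul_add, map_add, map_add, mul_add, h, h']
        | ht a' b' => rw [AlgTensor.tmul_mul, hF, hF, hF, AlgTensor.tmul_mul, map_mul, map_mul]
    map_star' := fun x ↦ by
      induction x using AlgTensor.induction with
      | h0 => simp
      | ha x x' h h' => rw [star_add, map_add, map_add, star_add, h, h']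
      | ht a b => rw [AlgTensor.star_tmul, hF, hF, AlgTensor.star_tmul, map_star, map_star] }

theorem AlgTensor.map_tmul (f : A →⋆ₙₐ[ℂ] A') (g : B →⋆ₙₐ[ℂ] B') (a : A) (b : B) :
    AlgTensor.map f g (tmul a b) = tmul (f a) (g b) := TensorProduct.map_tmul ..

/-- Pulling a representation back along a homomorphism. -/
def HilbertRep.comap (f : A →⋆ₙₐ[ℂ] A') (π : HilbertRep A') : HilbertRep A where
  space := π.space
  hom := π.hom.comp f

theorem repTensor_map (f : A →⋆ₙₐ[ℂ] A') (g : B →⋆ₙₐ[ℂ] B') (π : HilbertRep A') (σ : HilbertRep B')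
    (x : AlgTensor A B) :
    repTensor π σ (AlgTensor.map f g x) = repTensor (π.comap f) (σ.comap g) x := by
  induction x using AlgTensor.induction with
  | h0 => rw [map_zero, map_zero]; exact (map_zero _).symm
  | ha x y h h' => rw [map_add, map_add, h, h']; exact (map_add _ _ _).symm
  | ht a b => rw [AlgTensor.map_tmul, repTensor_tmul, repTensor_tmul]; rfl

theorem AlgTensor.norm_map_le (f : A →⋆ₙₐ[ℂ] A') (g : B →⋆ₙₐ[ℂ] B') (x : AlgTensor A B) :
    ‖AlgTensor.map f g x‖ ≤ ‖x‖ :=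
  norm_le (norm_nonneg x) fun π σ ↦ by rw [repTensor_map]; exact norm_repTensor_le _ _ x

/-- `ofAlg` as a homomorphism of *-algebras. -/
def ofAlgHom : AlgTensor A B →⋆ₙₐ[ℂ] A ⊗ₘ B where
  toFun := ofAlg
  map_smul' := map_smul ofAlg
  map_zero' := map_zero ofAlg
  map_add' := map_add ofAlg
  map_mul' := ofAlg_mul
  map_star' := ofAlg_star

/-- The homomorphism `f ⊗ g : A ⊗ B → A' ⊗ B'`. -/
def SpatialTensor.map (f : A →⋆ₙₐ[ℂ] A') (g : B →⋆ₙₐ[ℂ] B') : A ⊗ₘ B →⋆ₙₐ[ℂ] A' ⊗ₘ B' :=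
  extendHom denseRange_ofAlg ofAlg_mul ofAlg_star (ofAlgHom.comp (AlgTensor.map f g)) fun x ↦
    (ofAlg.norm_map _).le.trans (AlgTensor.norm_map_le f g x)

theorem SpatialTensor.map_ofAlg (f : A →⋆ₙₐ[ℂ] A') (g : B →⋆ₙₐ[ℂ] B') (x : AlgTensor A B) :
    SpatialTensor.map f g (ofAlg x) = ofAlg (AlgTensor.map f g x) :=
  extendHom_apply denseRange_ofAlg ofAlg_mul ofAlg_star _ _ x

theorem SpatialTensor.map_tmul (f : A →⋆ₙₐ[ℂ] A') (g : B →⋆ₙₐ[ℂ] B') (a : A) (b : B) :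
    SpatialTensor.map f g (tmul a b) = tmul (f a) (g b) := by
  rw [tmul, map_ofAlg, AlgTensor.map_tmul, tmul]

theorem SpatialTensor.hom_ext {E : Type u} [NonUnitalCStarAlgebra E] {f g : A ⊗ₘ B →⋆ₙₐ[ℂ] E}
    (h : ∀ a b, f (tmul a b) = g (tmul a b)) : f = g := by
  ext x
  induction x using SpatialTensor.induction with
  | hc => exact isClosed_eq (continuous_hom f) (continuous_hom g)
  | h0 => simp
  | ht a b => exact h a b
  | ha x y hx hy => rw [map_add, map_add, hx, hy]

end Map
end Spatial

section MultiplierRep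
variable {A : Type u} [NonUnitalCStarAlgebra A]

/-- The multiplier algebra. -/
abbrev Mult (A : Type u) [NonUnitalCStarAlgebra A] : Type u := 𝓜(ℂ, A)

variable (A) in
theorem exists_approximateUnit : ∃ l : Filter A, l.NeBot ∧ (∀ᶠ e in l, ‖e‖ ≤ 1) ∧
    (∀ᶠ e in l, star e = e) ∧ (∀ a, Tendsto (fun e ↦ a * e) l (𝓝 a)) ∧
    ∀ a, Tendsto (fun e ↦ e * a) l (𝓝 a) := by
  let _ := CStarAlgebra.spectralOrder A
  let _ := CStarAlgebra.spectralOrderedRing A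
  have h := CStarAlgebra.increasingApproximateUnit A
  exact ⟨_, h.neBot, h.eventually_norm, h.eventually_star_eq, h.tendsto_mul_left,
    h.tendsto_mul_right⟩

variable (A) in
/-- A fixed approximate unit. -/
def approxUnit : Filter A := (exists_approximateUnit A).choose

instance : (approxUnit A).NeBot := (exists_approximateUnit A).choose_spec.1

theorem approxUnit_norm : ∀ᶠ e in approxUnit A, ‖e‖ ≤ 1 :=
  (exists_approximateUnit A).choose_spec.2.1

theorem approxUnit_star : ∀ᶠ e in approxUnit A, star e = e :=
  (exists_approximateUnit A).choose_spec.2.2.1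

theorem tendsto_mul_approxUnit (a : A) : Tendsto (fun e ↦ a * e) (approxUnit A) (𝓝 a) :=
  (exists_approximateUnit A).choose_spec.2.2.2.1 a

theorem tendsto_approxUnit_mul (a : A) : Tendsto (fun e ↦ e * a) (approxUnit A) (𝓝 a) :=
  (exists_approximateUnit A).choose_spec.2.2.2.2 a

theorem Mult.fst_mul (m : Mult A) (a b : A) : m.fst (a * b) = m.fst a * b := by
  refine tendsto_nhds_unique (tendsto_approxUnit_mul _) ?_
  have h (e : A) : e * m.fst (a * b) = e * (m.fst a * b) := by
    rw [← m.central, ← mul_assoc, m.central, mul_assoc]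
  simp only [h]
  exact tendsto_approxUnit_mul _

theorem Mult.snd_mul (m : Mult A) (a b : A) : m.snd (a * b) = a * m.snd b := by
  refine tendsto_nhds_unique (tendsto_mul_approxUnit _) ?_
  have h (e : A) : m.snd (a * b) * e = a * m.snd b * e := by
    rw [m.central, mul_assoc, ← m.central, mul_assoc]
  simp only [h]
  exact tendsto_mul_approxUnit _

/-- Two multipliers with the same left action agree. -/
theorem Mult.ext_fst {m n : Mult A} (h : ∀ a, m.fst a = n.fst a) : m = n := by
  refine DoubleCentralizer.ext _ _ _ _ (Prod.ext (ContinuousLinearMap.ext h)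
    (ContinuousLinearMap.ext fun a ↦ ?_))
  refine tendsto_nhds_unique (tendsto_mul_approxUnit (m.snd a)) ?_
  have h (e : A) : m.snd a * e = n.snd a * e := by rw [m.central, n.central, h]
  simp only [h]
  exact tendsto_mul_approxUnit _

variable (π : HilbertRep A)

/-- Strong convergence of `π (m e)` along an approximate unit. -/
theorem HilbertRep.exists_limit (m : Mult A) (ξ : π.space) :
    ∃ η, Tendsto (fun e ↦ π.hom (m.fst e) ξ) (approxUnit A) (𝓝 η) := by
  let T (e : A) : π.space →L[ℂ] π.space := π.hom (m.fst e)
  have hT : ∀ᶠ e in approxUnit A, ‖T e‖ ≤ ‖m‖ := by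
    filter_upwards [approxUnit_norm] with e he
    calc ‖T e‖ ≤ ‖m.fst e‖ := NonUnitalStarAlgHom.norm_apply_le π.hom _
      _ ≤ ‖m.fst‖ * ‖e‖ := m.fst.le_opNorm e
      _ ≤ ‖m‖ * 1 := by rw [DoubleCentralizer.norm_fst]; gcongr
      _ = ‖m‖ := mul_one _
  let S : Submodule ℂ π.space :=
    { carrier := {ξ | ∃ η, Tendsto (fun e ↦ T e ξ) (approxUnit A) (𝓝 η)}
      zero_mem' := ⟨0, by simp⟩
      add_mem' := by
        rintro ξ ξ' ⟨η, h⟩ ⟨η', h'⟩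
        exact ⟨η + η', by simpa using h.add h'⟩
      smul_mem' := by
        rintro c ξ ⟨η, h⟩
        exact ⟨c • η, by simpa using h.const_smul c⟩ }
  have hS : IsClosed (S : Set π.space) := by
    refine isClosed_of_closure_subset fun ξ hξ ↦ ?_
    refine CompleteSpace.complete (f := map (fun e ↦ T e ξ) (approxUnit A)) ?_
    refine Metric.cauchy_iff.2 ⟨inferInstance, fun ε hε ↦ ?_⟩
    obtain ⟨ζ, ⟨η, hη⟩, hζ⟩ := Metric.mem_closure_iff.1 hξ (ε / (4 * (‖m‖ + 1))) (by positivity)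
    have h1 := hη.eventually (Metric.ball_mem_nhds η (ε := ε / 4) (by positivity))
    refine ⟨Metric.ball η (ε / 2), mem_map.2 ?_, fun x hx y hy ↦ ?_⟩
    · filter_upwards [h1, hT] with e h1 hT
      have h2 : ‖T e ξ - T e ζ‖ ≤ ‖m‖ * (ε / (4 * (‖m‖ + 1))) := by
        rw [← map_sub]
        refine ((T e).le_opNorm _).trans ?_
        rw [dist_eq_norm] at hζ
        gcongr
      have h3 : ‖m‖ * (ε / (4 * (‖m‖ + 1))) ≤ ε / 4 := by
        rw [mul_div_assoc', div_le_div_iff₀ (by positivity) (by norm_num)]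
        nlinarith [norm_nonneg m]
      rw [dist_eq_norm] at h1
      rw [Set.mem_preimage, Metric.mem_ball, dist_eq_norm]
      calc ‖T e ξ - η‖ = ‖(T e ξ - T e ζ) + (T e ζ - η)‖ := by congr 1; abel
        _ ≤ ‖T e ξ - T e ζ‖ + ‖T e ζ - η‖ := norm_add_le _ _
        _ < ε / 2 := by linarith
    · have := dist_triangle_right x y η
      rw [Metric.mem_ball] at hx hy
      linarith
  let K : Submodule ℂ π.space := (Submodule.span ℂ {ζ | ∃ a ξ, ζ = π.hom a ξ}).topologicalClosure
  have : CompleteSpace K := (Submodule.isClosed_topologicalClosure _).completeSpace_coe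
  have hK : K ≤ S := by
    refine Submodule.topologicalClosure_minimal _ (Submodule.span_le.2 ?_) hS
    rintro _ ⟨a, ξ, rfl⟩
    refine ⟨π.hom (m.fst a) ξ, ?_⟩
    have h := ((m.fst.continuous.tendsto a).comp (tendsto_approxUnit_mul a))
    have h' : Continuous fun b ↦ π.hom b ξ := (continuous_hom π.hom).clm_apply continuous_const
    convert (h'.tendsto _).comp h using 2 with e
    simp [T, Mult.fst_mul]
  have hK' : Kᗮ ≤ S := fun ξ hξ ↦ by
    refine ⟨0, ?_⟩
    have h (a : A) : π.hom a ξ = 0 := by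
      refine ext_inner_right ℂ fun ζ ↦ ?_
      rw [inner_zero_left, ← ContinuousLinearMap.adjoint_inner_right,
        ← ContinuousLinearMap.star_eq_adjoint, ← map_star]
      exact (Submodule.mem_orthogonal' _ _).1 hξ _
        (Submodule.le_topologicalClosure _ (Submodule.subset_span ⟨_, _, rfl⟩))
    simp [T, h]
  have h := K.starProjection_add_starProjection_orthogonal ξ
  rw [← h]
  exact S.add_mem (hK (by simp)) (hK' (by simp))

/-- The canonical extension of a representation to the multiplier algebra: the strong limit of
`π (m e)` for `e` in an approximate unit (it vanishes on the complement of the essential subspace of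
`π`). -/
def HilbertRep.extFun (m : Mult A) (ξ : π.space) : π.space := (π.exists_limit m ξ).choose

theorem HilbertRep.tendsto_extFun (m : Mult A) (ξ : π.space) :
    Tendsto (fun e ↦ π.hom (m.fst e) ξ) (approxUnit A) (𝓝 (π.extFun m ξ)) :=
  (π.exists_limit m ξ).choose_spec

theorem HilbertRep.norm_extFun_le (m : Mult A) (ξ : π.space) : ‖π.extFun m ξ‖ ≤ ‖m‖ * ‖ξ‖ := by
  refine le_of_tendsto (π.tendsto_extFun m ξ).norm ?_
  filter_upwards [approxUnit_norm] with e he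
  refine (ContinuousLinearMap.le_opNorm _ _).trans ?_
  gcongr
  calc ‖π.hom (m.fst e)‖ ≤ ‖m.fst e‖ := NonUnitalStarAlgHom.norm_apply_le π.hom _
    _ ≤ ‖m.fst‖ * ‖e‖ := m.fst.le_opNorm e
    _ ≤ ‖m‖ * 1 := by rw [DoubleCentralizer.norm_fst]; gcongr
    _ = ‖m‖ := mul_one _

/-- The canonical extension of a representation to the multiplier algebra, as operators. -/
def HilbertRep.extL (m : Mult A) : π.space →L[ℂ] π.space :=
  LinearMap.mkContinuous
    { toFun := π.extFun m
      map_add' := fun ξ η ↦ tendsto_nhds_unique (π.tendsto_extFun m _) <| by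
        simpa using (π.tendsto_extFun m ξ).add (π.tendsto_extFun m η)
      map_smul' := fun c ξ ↦ tendsto_nhds_unique (π.tendsto_extFun m _) <| by
        simpa using (π.tendsto_extFun m ξ).const_smul c }
    ‖m‖ (π.norm_extFun_le m)

theorem HilbertRep.tendsto_extL (m : Mult A) (ξ : π.space) :
    Tendsto (fun e ↦ π.hom (m.fst e) ξ) (approxUnit A) (𝓝 (π.extL m ξ)) :=
  π.tendsto_extFun m ξ

theorem HilbertRep.extL_hom (m : Mult A) (a : A) (ξ : π.space) :
    π.extL m (π.hom a ξ) = π.hom (m.fst a) ξ := by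
  refine tendsto_nhds_unique (π.tendsto_extL m _) ?_
  have h := (m.fst.continuous.tendsto a).comp (tendsto_approxUnit_mul a)
  have h' : Continuous fun b ↦ π.hom b ξ := (continuous_hom π.hom).clm_apply continuous_const
  convert (h'.tendsto _).comp h using 2 with e
  simp [Mult.fst_mul]

theorem HilbertRep.hom_extL (m : Mult A) (a : A) (ξ : π.space) :
    π.hom a (π.extL m ξ) = π.hom (m.snd a) ξ := by
  refine tendsto_nhds_unique (((π.hom a).continuous.tendsto _).comp (π.tendsto_extL m ξ)) ?_
  have h' : Continuous fun b ↦ π.hom b ξ := (continuous_hom π.hom).clm_apply continuous_const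
  convert (h'.tendsto _).comp (tendsto_mul_approxUnit (m.snd a)) using 1
  ext e
  simp [m.central]

theorem HilbertRep.extL_mul (m n : Mult A) (ξ : π.space) :
    π.extL (m * n) ξ = π.extL m (π.extL n ξ) := by
  refine tendsto_nhds_unique (π.tendsto_extL _ ξ) ?_
  simpa [Function.comp_def, HilbertRep.extL_hom] using
    ((π.extL m).continuous.tendsto _).comp (π.tendsto_extL n ξ)

theorem HilbertRep.extL_star (m : Mult A) (ξ η : π.space) :
    inner ℂ (π.extL (star m) ξ) η = inner ℂ ξ (π.extL m η) := by
  have h1 : Tendsto (fun e ↦ inner ℂ (π.hom ((star m).fst e) ξ) η) (approxUnit A)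
      (𝓝 (inner ℂ (π.extL (star m) ξ) η)) := (π.tendsto_extL _ ξ).inner tendsto_const_nhds
  refine tendsto_nhds_unique h1 ?_
  have h2 : π.extL m η = π.extL 1 (π.extL m η) := by rw [← HilbertRep.extL_mul, one_mul]
  have h3 : Tendsto (fun e ↦ inner ℂ ξ (π.hom e (π.extL m η))) (approxUnit A)
      (𝓝 (inner ℂ ξ (π.extL m η))) := by
    rw [h2]
    simpa [← h2] using tendsto_const_nhds.inner (π.tendsto_extL 1 (π.extL m η))
  refine h3.congr' ?_
  filter_upwards [approxUnit_star] with e he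
  rw [HilbertRep.hom_extL, DoubleCentralizer.star_fst, he, map_star,
    ContinuousLinearMap.star_eq_adjoint, ContinuousLinearMap.adjoint_inner_left]

/-- The canonical extension of a representation to the multiplier algebra. -/
def HilbertRep.ext : HilbertRep (Mult A) where
  space := π.space
  hom :=
    { toFun := π.extL
      map_smul' := fun c m ↦ ContinuousLinearMap.ext fun ξ ↦
        tendsto_nhds_unique (π.tendsto_extL _ ξ) <| by
          simpa using (π.tendsto_extL m ξ).const_smul c
      map_zero' := ContinuousLinearMap.ext fun ξ ↦
        tendsto_nhds_unique (π.tendsto_extL _ ξ) <| by simp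
      map_add' := fun m n ↦ ContinuousLinearMap.ext fun ξ ↦
        tendsto_nhds_unique (π.tendsto_extL _ ξ) <| by
          simpa using (π.tendsto_extL m ξ).add (π.tendsto_extL n ξ)
      map_mul' := fun m n ↦ ContinuousLinearMap.ext fun ξ ↦ π.extL_mul m n ξ
      map_star' := fun m ↦ ContinuousLinearMap.ext fun ξ ↦ ext_inner_right ℂ fun η ↦ by
        rw [HilbertRep.extL_star, ContinuousLinearMap.star_eq_adjoint,
          ContinuousLinearMap.adjoint_inner_left] }

/-- The inclusion of a C*-algebra in its multiplier algebra. -/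
abbrev toMult : A →⋆ₙₐ[ℂ] Mult A := DoubleCentralizer.coeHom

theorem HilbertRep.comap_ext : π.ext.comap toMult = π := by
  have h : π.ext.hom.comp (toMult : A →⋆ₙₐ[ℂ] Mult A) = π.hom := by
    ext a ξ
    change π.extL (toMult a) ξ = π.hom a ξ
    refine tendsto_nhds_unique (π.tendsto_extL (toMult a) ξ) ?_
    have h' : Continuous fun b ↦ π.hom b ξ := (continuous_hom π.hom).clm_apply continuous_const
    exact (h'.tendsto _).comp (tendsto_mul_approxUnit a)
  exact congrArg (fun f : A →⋆ₙₐ[ℂ] (π.space →L[ℂ] π.space) ↦ (⟨π.space, f⟩ : HilbertRep A)) h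

end MultiplierRep

section TensorMult
variable {A B : Type u} [NonUnitalCStarAlgebra A] [NonUnitalCStarAlgebra B]

/-- The inclusion `A ⊗ B → M(A) ⊗ M(B)`. -/
def inclMult : A ⊗ₘ B →⋆ₙₐ[ℂ] Mult A ⊗ₘ Mult B := SpatialTensor.map toMult toMult

theorem norm_inclMult (x : A ⊗ₘ B) : ‖inclMult x‖ = ‖x‖ := by
  induction x using denseRange_ofAlg.induction_on with
  | hp => exact isClosed_eq (continuous_hom _).norm continuous_norm
  | ih x =>
    rw [inclMult, SpatialTensor.map_ofAlg, ofAlg.norm_map, ofAlg.norm_map]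
    refine le_antisymm (AlgTensor.norm_map_le _ _ x) (AlgTensor.norm_le (norm_nonneg _) fun π σ ↦ ?_)
    calc ‖repTensor π σ x‖ = ‖repTensor (π.ext.comap toMult) (σ.ext.comap toMult) x‖ := by
          rw [HilbertRep.comap_ext, HilbertRep.comap_ext]
      _ = ‖repTensor π.ext σ.ext (AlgTensor.map toMult toMult x)‖ :=
          congrArg norm (repTensor_map toMult toMult π.ext σ.ext x).symm
      _ ≤ _ := norm_repTensor_le ..

end TensorMult

section Ideal
variable {J D : Type u} [NonUnitalCStarAlgebra J] [NonUnitalCStarAlgebra D] (i : J →⋆ₙₐ[ℂ] D)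
  (hi : ∀ x, ‖i x‖ = ‖x‖) (hl : ∀ d x, ∃ y, i y = d * i x)

theorem injective_of_norm (hi : ∀ x, ‖i x‖ = ‖x‖) : Function.Injective i := fun x y h ↦ by
  rw [← sub_eq_zero, ← norm_eq_zero, ← hi, map_sub, h, sub_self, norm_zero]

/-- Left multiplication of an ideal `J` of `D` by an element of `D`. -/
def idealL (d : D) : J →L[ℂ] J :=
  have hL (x : J) : i (hl d x).choose = d * i x := (hl d x).choose_spec
  LinearMap.mkContinuous
    { toFun := fun x ↦ (hl d x).choose
      map_add' := fun x y ↦ injective_of_norm i hi <| by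
        rw [hL, map_add, map_add, hL, hL, mul_add]
      map_smul' := fun c x ↦ injective_of_norm i hi <| by
        rw [hL, map_smul, RingHom.id_apply, map_smul, hL, mul_smul_comm] }
    ‖d‖ fun x ↦ by
      change ‖(hl d x).choose‖ ≤ _
      rw [← hi, hL, ← hi x]
      exact norm_mul_le _ _

theorem idealL_spec (d : D) (x : J) : i (idealL i hi hl d x) = d * i x := (hl d x).choose_spec

/-- Right multiplication of an ideal `J` of `D` by an element of `D`. -/
def idealR (d : D) : J →L[ℂ] J :=
  (((starₗᵢ ℂ : J ≃ₗᵢ⋆[ℂ] J) : J →L⋆[ℂ] J).comp (idealL i hi hl (star d))).comp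
    ((starₗᵢ ℂ : J ≃ₗᵢ⋆[ℂ] J) : J →L⋆[ℂ] J)

theorem idealR_spec (d : D) (x : J) : i (idealR i hi hl d x) = i x * d := by
  change i (star (idealL i hi hl (star d) (star x))) = _
  rw [map_star, idealL_spec, map_star, star_mul, star_star, star_star]

/-- The canonical homomorphism `D → M(J)` for an ideal `J` of `D`. -/
def idealHom : D →⋆ₙₐ[ℂ] Mult J :=
  have inj := injective_of_norm i hi
  { toFun := fun d ↦
      { fst := idealL i hi hl d
        snd := idealR i hi hl d
        central := fun x y ↦ inj <| by
          rw [map_mul, map_mul, idealL_spec, idealR_spec, mul_assoc] }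
    map_smul' := fun c d ↦ Mult.ext_fst fun x ↦ inj <| by
      change i (idealL i hi hl (c • d) x) = i (c • idealL i hi hl d x)
      rw [map_smul, idealL_spec, idealL_spec, smul_mul_assoc]
    map_zero' := Mult.ext_fst fun x ↦ inj <| by
      change i (idealL i hi hl 0 x) = i 0
      rw [idealL_spec, zero_mul, map_zero]
    map_add' := fun c d ↦ Mult.ext_fst fun x ↦ inj <| by
      change i (idealL i hi hl (c + d) x) = i (idealL i hi hl c x + idealL i hi hl d x)
      rw [map_add, idealL_spec, idealL_spec, idealL_spec, add_mul]
    map_mul' := fun c d ↦ Mult.ext_fst fun x ↦ inj <| by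
      change i (idealL i hi hl (c * d) x) = i (idealL i hi hl c (idealL i hi hl d x))
      rw [idealL_spec, idealL_spec, idealL_spec, mul_assoc]
    map_star' := fun d ↦ Mult.ext_fst fun x ↦ inj <| by
      rw [DoubleCentralizer.star_fst]
      change i (idealL i hi hl (star d) x) = i (star (idealR i hi hl d (star x)))
      rw [idealL_spec, map_star, idealR_spec, map_star, star_mul, star_star] }

theorem idealHom_spec (d : D) (x : J) : i ((idealHom i hi hl d).fst x) = d * i x :=
  idealL_spec i hi hl d x

end Ideal

section TensorMult
variable {A B : Type u} [NonUnitalCStarAlgebra A] [NonUnitalCStarAlgebra B]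

theorem inclMult_ideal (d : Mult A ⊗ₘ Mult B) (x : A ⊗ₘ B) : ∃ y, inclMult y = d * inclMult x := by
  have hcl : IsClosed (Set.range (inclMult : A ⊗ₘ B → Mult A ⊗ₘ Mult B)) :=
    (AddMonoidHomClass.isometry_of_norm (inclMult : A ⊗ₘ B →⋆ₙₐ[ℂ] _)
      norm_inclMult).isClosedEmbedding.isClosed_range
  change d * inclMult x ∈ Set.range (inclMult : A ⊗ₘ B → Mult A ⊗ₘ Mult B)
  induction d using SpatialTensor.induction with
  | hc => exact hcl.preimage (f := fun d ↦ d * inclMult x) (by fun_prop)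
  | h0 => exact ⟨0, by rw [map_zero, zero_mul]⟩
  | ha d d' h h' =>
    obtain ⟨y, hy⟩ := h
    obtain ⟨y', hy'⟩ := h'
    exact ⟨y + y', by rw [map_add, hy, hy', add_mul]⟩
  | ht m n =>
    induction x using SpatialTensor.induction with
    | hc =>
      exact hcl.preimage (f := fun x ↦ tmul m n * inclMult x)
        (continuous_const.mul (continuous_hom inclMult))
    | h0 => exact ⟨0, by rw [map_zero, mul_zero]⟩
    | ha x x' h h' =>
      obtain ⟨y, hy⟩ := h
      obtain ⟨y', hy'⟩ := h'
      exact ⟨y + y', by rw [map_add, map_add, hy, hy', mul_add]⟩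
    | ht a b =>
      have h {E : Type u} [NonUnitalCStarAlgebra E] (m : Mult E) (a : E) :
          toMult (m.fst a) = m * toMult a := Mult.ext_fst fun b ↦ (m.fst_mul a b).symm
      exact ⟨tmul (m.fst a) (n.fst b), by
        rw [inclMult, SpatialTensor.map_tmul, SpatialTensor.map_tmul, tmul_mul, h, h]⟩

/-- The canonical homomorphism `M(A) ⊗ M(B) → M(A ⊗ B)`. -/
def multTensor : Mult A ⊗ₘ Mult B →⋆ₙₐ[ℂ] Mult (A ⊗ₘ B) :=
  idealHom inclMult norm_inclMult inclMult_ideal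

/-- `multTensor` is determined by `(m ⊗ n)(a ⊗ b) = ma ⊗ nb`. -/
theorem multTensor_tmul (m : Mult A) (n : Mult B) (a : A) (b : B) :
    (multTensor (tmul m n)).fst (tmul a b) = tmul (m.fst a) (n.fst b) := by
  refine injective_of_norm inclMult norm_inclMult ?_
  have h {E : Type u} [NonUnitalCStarAlgebra E] (m : Mult E) (a : E) :
      toMult (m.fst a) = m * toMult a := Mult.ext_fst fun b ↦ (m.fst_mul a b).symm
  rw [multTensor, idealHom_spec, inclMult, SpatialTensor.map_tmul, SpatialTensor.map_tmul, tmul_mul,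
    h, h]

end TensorMult

section Morphisms
variable {A B C A' B' : Type u} [NonUnitalCStarAlgebra A] [NonUnitalCStarAlgebra B]
  [NonUnitalCStarAlgebra C] [NonUnitalCStarAlgebra A'] [NonUnitalCStarAlgebra B']

/-- The tensor product `f ⊗ g : A ⊗ B → M(A' ⊗ B')` of two homomorphisms `f : A → M(A')` and
`g : B → M(B')`. With `toMult` for `f` or `g` this gives `id ⊗ g` and `f ⊗ id`. -/
def tensorHom (f : A →⋆ₙₐ[ℂ] Mult A') (g : B →⋆ₙₐ[ℂ] Mult B') : A ⊗ₘ B →⋆ₙₐ[ℂ] Mult (A' ⊗ₘ B') :=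
  multTensor.comp (SpatialTensor.map f g)

theorem tensorHom_tmul (f : A →⋆ₙₐ[ℂ] Mult A') (g : B →⋆ₙₐ[ℂ] Mult B') (a : A) (b : B)
    (a' : A') (b' : B') :
    (tensorHom f g (tmul a b)).fst (tmul a' b') = tmul ((f a).fst a') ((g b).fst b') := by
  change (multTensor (SpatialTensor.map f g (tmul a b))).fst (tmul a' b') = _
  rw [SpatialTensor.map_tmul, multTensor_tmul]

/-- A homomorphism `f : A → M(B)` is non-degenerate if `f(A)B` spans a dense subspace of `B`
(then so does `B f(A)`, by taking adjoints). -/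
def IsNondegenerate (f : A →⋆ₙₐ[ℂ] Mult B) : Prop :=
  (Submodule.span ℂ {y : B | ∃ a b, y = (f a).fst b}).topologicalClosure = ⊤

/-- `n ∈ M(B)` is the value at `m ∈ M(A)` of the canonical (strictly continuous) extension
`M(A) → M(B)` of the homomorphism `f : A → M(B)`: `n f(a) = f(ma)` and `f(a) n = f(am)` for all
`a ∈ A`. For non-degenerate `f` there is exactly one such `n` for each `m`. -/
def IsExtensionValue (f : A →⋆ₙₐ[ℂ] Mult B) (m : Mult A) (n : Mult B) : Prop :=
  ∀ a, n * f a = f (m.fst a) ∧ f a * n = f (m.snd a)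

theorem IsExtensionValue.unique {f : A →⋆ₙₐ[ℂ] Mult B} (hf : IsNondegenerate f) {m : Mult A}
    {n n' : Mult B} (h : IsExtensionValue f m n) (h' : IsExtensionValue f m n') : n = n' := by
  refine Mult.ext_fst fun b ↦ ?_
  let K := LinearMap.eqLocus (n.fst : B →ₗ[ℂ] B) (n'.fst : B →ₗ[ℂ] B)
  have hK : IsClosed (K : Set B) := isClosed_eq n.fst.continuous n'.fst.continuous
  have hle : Submodule.span ℂ {y : B | ∃ a b, y = (f a).fst b} ≤ K := Submodule.span_le.2 (by
    rintro _ ⟨a, b, rfl⟩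
    change (n * f a).fst b = (n' * f a).fst b
    rw [(h a).1, (h' a).1])
  have h1 := Submodule.topologicalClosure_minimal _ hle hK
  rw [hf] at h1
  exact h1 (Submodule.mem_top (x := b))

variable (A B C) in
/-- The graph of the canonical isomorphism `(A ⊗ B) ⊗ C ≅ A ⊗ (B ⊗ C)`, that is, of the unique
bounded linear map with `(a ⊗ b) ⊗ c ↦ a ⊗ (b ⊗ c)`. -/
def assocGraph : Submodule ℂ (((A ⊗ₘ B) ⊗ₘ C) × (A ⊗ₘ (B ⊗ₘ C))) :=
  (Submodule.span ℂ {p | ∃ a b c, p = (tmul (tmul a b) c, tmul a (tmul b c))}).topologicalClosure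

/-- The multipliers `m` of `(A ⊗ B) ⊗ C` and `n` of `A ⊗ (B ⊗ C)` agree when the two tensor products
are identified in the canonical way. -/
def MultAssoc (m : Mult ((A ⊗ₘ B) ⊗ₘ C)) (n : Mult (A ⊗ₘ (B ⊗ₘ C))) : Prop :=
  ∀ p ∈ assocGraph A B C, (m.fst p.1, n.fst p.2) ∈ assocGraph A B C

end Morphisms

section Slices
variable {A B : Type u} [NonUnitalCStarAlgebra A] [NonUnitalCStarAlgebra B]

/-- `s ∈ B` is the slice `(ω ⊗ id)(X)` of the multiplier `X` of `A ⊗ B`: for a factorization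
`ω = ω'(· c)` (which every bounded functional has), `s d = (ω' ⊗ id)(X (c ⊗ d))` for all `d`,
where `ω' ⊗ id = S` is the usual slice map on `A ⊗ B`. -/
def IsLeftSlice (ω : A →L[ℂ] ℂ) (X : Mult (A ⊗ₘ B)) (s : B) : Prop :=
  ∃ (ω' : A →L[ℂ] ℂ) (c : A) (S : A ⊗ₘ B →L[ℂ] B), (∀ a, ω a = ω' (a * c)) ∧
    (∀ a b, S (tmul a b) = ω' a • b) ∧ ∀ d, s * d = S (X.fst (tmul c d))

/-- `s ∈ A` is the slice `(id ⊗ ω)(X)` of the multiplier `X` of `A ⊗ B`. -/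
def IsRightSlice (ω : B →L[ℂ] ℂ) (X : Mult (A ⊗ₘ B)) (s : A) : Prop :=
  ∃ (ω' : B →L[ℂ] ℂ) (c : B) (S : A ⊗ₘ B →L[ℂ] A), (∀ b, ω b = ω' (b * c)) ∧
    (∀ a b, S (tmul a b) = ω' b • a) ∧ ∀ d, s * d = S (X.fst (tmul d c))

/-- Positive bounded functionals. -/
def IsPositiveFunctional (ω : A →L[ℂ] ℂ) : Prop :=
  ∀ a, 0 ≤ (ω (star a * a)).re ∧ (ω (star a * a)).im = 0

end Slices

section Weights
open scoped ENNReal NNReal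
variable {A : Type u} [NonUnitalCStarAlgebra A]

/-- Positive elements of a C*-algebra. -/
def IsPos (a : A) : Prop := ∃ b, a = star b * b

/-- Proper weights on a C*-algebra: non-zero, densely defined, lower semicontinuous weights. A weight
is a function on the positive cone; the values of `φ` off the positive cone play no role. -/
structure IsProperWeight (φ : A → ℝ≥0∞) : Prop where
  map_add : ∀ a b, IsPos a → IsPos b → φ (a + b) = φ a + φ b
  map_smul : ∀ (r : ℝ≥0) a, IsPos a → φ ((r : ℂ) • a) = r * φ a
  ne_zero : ∃ a, IsPos a ∧ φ a ≠ 0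
  dense : {a | IsPos a} ⊆ closure {a | IsPos a ∧ φ a < ∞}
  lowerSemicontinuous : LowerSemicontinuousOn φ {a | IsPos a}

/-- Faithful weights. -/
def IsFaithfulWeight (φ : A → ℝ≥0∞) : Prop := ∀ a, IsPos a → φ a = 0 → a = 0

/-- A GNS construction `(H, π, Λ)` for the weight `φ`; only the values of `Λ` on the left ideal
`N_φ = {a | φ(a* a) < ∞}` matter. -/
structure WeightGNS (φ : A → ℝ≥0∞) extends HilbertRep A where
  lam : A → space
  lam_add : ∀ a b, φ (star a * a) < ∞ → φ (star b * b) < ∞ → lam (a + b) = lam a + lam b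
  lam_smul : ∀ (c : ℂ) a, φ (star a * a) < ∞ → lam (c • a) = c • lam a
  norm_lam : ∀ a, φ (star a * a) < ∞ → ENNReal.ofReal (‖lam a‖ ^ 2) = φ (star a * a)
  lam_mul : ∀ a b, φ (star b * b) < ∞ → lam (a * b) = hom a (lam b)
  dense : Dense {ξ | ∃ a, φ (star a * a) < ∞ ∧ ξ = lam a}

/-- The W*-lift of `φ` to the von Neumann algebra `π(A)''`: its value at `x ≥ 0` is the supremum of
`η(x)` over the normal positive functionals `η` with `η ∘ π ≤ φ`. A normal positive functional is one
of the form `x ↦ ∑ ⟨ξ n, x (ξ n)⟩` with `∑ ‖ξ n‖² < ∞`. -/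
def WeightGNS.lift {φ : A → ℝ≥0∞} (S : WeightGNS φ) (x : S.space →L[ℂ] S.space) : ℝ≥0∞ :=
  ⨆ (ξ : ℕ → S.space) (_ : Summable fun n ↦ ‖ξ n‖ ^ 2)
    (_ : ∀ a, IsPos a → ∑' n, ENNReal.ofReal (inner ℂ (ξ n) (S.hom a (ξ n))).re ≤ φ a),
    ∑' n, ENNReal.ofReal (inner ℂ (ξ n) (x (ξ n))).re

/-- Approximate KMS weights: proper weights whose W*-lift to `π(A)''` is faithful. -/
def IsApproxKMS (φ : A → ℝ≥0∞) : Prop :=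
  IsProperWeight φ ∧ ∃ S : WeightGNS φ, ∀ x ∈ Set.centralizer (Set.centralizer (Set.range S.hom)),
    x.IsPositive → S.lift x = 0 → x = 0

/-- Left invariance: `φ((ω ⊗ id)Δ(a)) = ω(1) φ(a)` for positive functionals `ω` (for which
`ω(1) = ‖ω‖`) and positive `a` with `φ(a) < ∞`. -/
def IsLeftInvariant (Δ : A →⋆ₙₐ[ℂ] Mult (A ⊗ₘ A)) (φ : A → ℝ≥0∞) : Prop :=
  ∀ (ω : A →L[ℂ] ℂ) (a s : A), IsPositiveFunctional ω → IsPos a → φ a < ∞ →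
    IsLeftSlice ω (Δ a) s → φ s = ENNReal.ofReal ‖ω‖ * φ a

/-- Right invariance: `φ((id ⊗ ω)Δ(a)) = ω(1) φ(a)`. -/
def IsRightInvariant (Δ : A →⋆ₙₐ[ℂ] Mult (A ⊗ₘ A)) (φ : A → ℝ≥0∞) : Prop :=
  ∀ (ω : A →L[ℂ] ℂ) (a s : A), IsPositiveFunctional ω → IsPos a → φ a < ∞ →
    IsRightSlice ω (Δ a) s → φ s = ENNReal.ofReal ‖ω‖ * φ a

end Weights

/-- A locally compact quantum group `G`, given by its (reduced) function algebra `C₀(G)` with the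
comultiplication `Δ`. -/
structure LocallyCompactQuantumGroup where
  /-- the C*-algebra `C₀(G)` -/
  alg : Type u
  [cstar : NonUnitalCStarAlgebra alg]
  /-- the comultiplication -/
  Δ : alg →⋆ₙₐ[ℂ] Mult (alg ⊗ₘ alg)
  nondegenerate : IsNondegenerate Δ
  /-- `(Δ ⊗ id)Δ = (id ⊗ Δ)Δ` -/
  coassoc : ∀ a, ∃ m n, IsExtensionValue (tensorHom Δ toMult) (Δ a) m ∧
    IsExtensionValue (tensorHom toMult Δ) (Δ a) n ∧ MultAssoc m n
  exists_leftSlice : ∀ (ω : alg →L[ℂ] ℂ) a, ∃ s, IsLeftSlice ω (Δ a) s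
  exists_rightSlice : ∀ (ω : alg →L[ℂ] ℂ) a, ∃ s, IsRightSlice ω (Δ a) s
  dense_leftSlice :
    (Submodule.span ℂ {s | ∃ (ω : alg →L[ℂ] ℂ) (a : alg), IsLeftSlice ω (Δ a) s}).topologicalClosure
      = ⊤
  dense_rightSlice :
    (Submodule.span ℂ {s | ∃ (ω : alg →L[ℂ] ℂ) (a : alg), IsRightSlice ω (Δ a) s}).topologicalClosure
      = ⊤
  exists_leftHaar : ∃ φ, IsApproxKMS φ ∧ IsFaithfulWeight φ ∧ IsLeftInvariant Δ φ
  exists_rightHaar : ∃ ψ, IsApproxKMS ψ ∧ IsRightInvariant Δ ψ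

attribute [instance] LocallyCompactQuantumGroup.cstar

section Actions
variable (G : LocallyCompactQuantumGroup.{u})

/-- The multiplier `c ⊗ 1` of `C ⊗ A`. -/
def tmulOne {C : Type u} [NonUnitalCStarAlgebra C] (A : Type u) [NonUnitalCStarAlgebra A] (c : C) :
    Mult (C ⊗ₘ A) :=
  multTensor (tmul (toMult c) (1 : Mult A))

/-- The elements of `M_A(C ⊗ A)`: the multipliers `X` of `C ⊗ A` such that `X (c ⊗ 1)` and
`(c ⊗ 1) X` are in `C ⊗ A` for all `c ∈ C`. -/
def IsRelMult {C A : Type u} [NonUnitalCStarAlgebra C] [NonUnitalCStarAlgebra A]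
    (X : Mult (C ⊗ₘ A)) : Prop :=
  ∀ c : C, (∃ y, toMult y = X * tmulOne A c) ∧ ∃ y, toMult y = tmulOne A c * X

/-- An action of `G` on the C*-algebra `A`. -/
@[ext]
structure QAction (A : Type u) [NonUnitalCStarAlgebra A] where
  ρ : A →⋆ₙₐ[ℂ] Mult (G.alg ⊗ₘ A)
  nondegenerate : IsNondegenerate ρ
  /-- `(Δ ⊗ id)ρ = (id ⊗ ρ)ρ` -/
  coassoc : ∀ a, ∃ m n, IsExtensionValue (tensorHom G.Δ toMult) (ρ a) m ∧
    IsExtensionValue (tensorHom toMult ρ) (ρ a) n ∧ MultAssoc m n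
  relMult : ∀ a, IsRelMult (ρ a)
  /-- `ρ(A)(C₀(G) ⊗ ℂ)` spans a dense subspace of `C₀(G) ⊗ A`. -/
  dense : (Submodule.span ℂ
    {y : G.alg ⊗ₘ A | ∃ a c, toMult y = ρ a * tmulOne A c}).topologicalClosure = ⊤

variable {G} in
/-- Equivariance of a homomorphism `f : A → B` of unital C*-algebras:
`(id ⊗ f) ρ_A = ρ_B f`, where `id ⊗ f` is extended to multipliers. -/
def IsEquivariant {A B : Type u} [CStarAlgebra A] [CStarAlgebra B] (ρA : QAction G A)
    (ρB : QAction G B) (f : A →⋆ₐ[ℂ] B) : Prop :=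
  ∀ a, IsExtensionValue (toMult.comp (SpatialTensor.map (.id ℂ G.alg) (f : A →⋆ₙₐ[ℂ] B)))
    (ρA.ρ a) (ρB.ρ (f a))

end Actions

section Categories
open CategoryTheory

/-- The category of unital C*-algebras and unital *-homomorphisms. -/
structure UnitalCStarCat where
  carrier : Type u
  [cstar : CStarAlgebra carrier]

attribute [instance] UnitalCStarCat.cstar

instance : Category UnitalCStarCat.{u} where
  Hom A B := A.carrier →⋆ₐ[ℂ] B.carrier
  id A := StarAlgHom.id ℂ A.carrier
  comp f g := g.comp f

variable (G : LocallyCompactQuantumGroup.{u})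

/-- The category of unital C*-algebras with an action of `G`, with equivariant unital
*-homomorphisms. -/
structure EquivariantCStarCat where
  obj : UnitalCStarCat.{u}
  action : QAction G obj.carrier

variable {G} in
/-- Morphisms of unital C*-algebras with an action of `G`. -/
@[ext]
structure EquivariantCStarCat.Hom (A B : EquivariantCStarCat G) where
  hom : A.obj ⟶ B.obj
  equivariant : IsEquivariant A.action B.action hom

theorem Mult.mul_toMult {A : Type u} [NonUnitalCStarAlgebra A] (m : Mult A) (a : A) :
    m * toMult a = toMult (m.fst a) :=
  Mult.ext_fst fun x ↦ Mult.fst_mul m a x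

theorem Mult.toMult_mul {A : Type u} [NonUnitalCStarAlgebra A] (m : Mult A) (a : A) :
    toMult a * m = toMult (m.snd a) :=
  Mult.ext_fst fun x ↦ (m.central a x).symm

theorem toMult_injective {A : Type u} [NonUnitalCStarAlgebra A] :
    Function.Injective (toMult : A →⋆ₙₐ[ℂ] Mult A) := by
  intro a b h
  refine tendsto_nhds_unique (tendsto_mul_approxUnit a) ?_
  have h (e : A) : a * e = b * e := congrArg (fun m : Mult A ↦ m.fst e) h
  simp only [h]
  exact tendsto_mul_approxUnit b

/-- The two conditions of `IsEquivariant` without the inclusion into the multiplier algebra. -/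
theorem isEquivariant_iff {A B : Type u} [CStarAlgebra A] [CStarAlgebra B] {ρA : QAction G A}
    {ρB : QAction G B} {f : A →⋆ₐ[ℂ] B} : IsEquivariant ρA ρB f ↔ ∀ a x,
      (ρB.ρ (f a)).fst (SpatialTensor.map (.id ℂ G.alg) (f : A →⋆ₙₐ[ℂ] B) x) =
        SpatialTensor.map (.id ℂ G.alg) (f : A →⋆ₙₐ[ℂ] B) ((ρA.ρ a).fst x) ∧
      (ρB.ρ (f a)).snd (SpatialTensor.map (.id ℂ G.alg) (f : A →⋆ₙₐ[ℂ] B) x) =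
        SpatialTensor.map (.id ℂ G.alg) (f : A →⋆ₙₐ[ℂ] B) ((ρA.ρ a).snd x) := by
  refine forall_congr' fun a ↦ forall_congr' fun x ↦ and_congr ?_ ?_
  · exact Iff.trans (by rw [← Mult.mul_toMult]; rfl) toMult_injective.eq_iff
  · exact Iff.trans (by rw [← Mult.toMult_mul]; rfl) toMult_injective.eq_iff

theorem IsEquivariant.id {A : Type u} [CStarAlgebra A] (ρ : QAction G A) :
    IsEquivariant ρ ρ (StarAlgHom.id ℂ A) := by
  have h : SpatialTensor.map (.id ℂ G.alg) (StarAlgHom.id ℂ A : A →⋆ₙₐ[ℂ] A) = .id ℂ _ :=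
    SpatialTensor.hom_ext fun c a ↦ SpatialTensor.map_tmul ..
  refine (isEquivariant_iff G).2 fun a x ↦ ?_
  rw [h]
  exact ⟨rfl, rfl⟩

theorem IsEquivariant.comp {A B C : Type u} [CStarAlgebra A] [CStarAlgebra B] [CStarAlgebra C]
    {ρA : QAction G A} {ρB : QAction G B} {ρC : QAction G C} {g : B →⋆ₐ[ℂ] C} {f : A →⋆ₐ[ℂ] B}
    (hg : IsEquivariant ρB ρC g) (hf : IsEquivariant ρA ρB f) :
    IsEquivariant ρA ρC (g.comp f) := by
  have h : SpatialTensor.map (.id ℂ G.alg) (g.comp f : A →⋆ₙₐ[ℂ] C) =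
      (SpatialTensor.map (.id ℂ G.alg) (g : B →⋆ₙₐ[ℂ] C)).comp
        (SpatialTensor.map (.id ℂ G.alg) (f : A →⋆ₙₐ[ℂ] B)) :=
    SpatialTensor.hom_ext fun c a ↦ by
      rw [NonUnitalStarAlgHom.comp_apply]
      simp only [SpatialTensor.map_tmul]
      rfl
  rw [isEquivariant_iff] at hg hf ⊢
  intro a x
  rw [h]
  constructor
  · exact (hg (f a) _).1.trans (congrArg _ (hf a x).1)
  · exact (hg (f a) _).2.trans (congrArg _ (hf a x).2)

instance : Category (EquivariantCStarCat G) where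
  Hom A B := A.Hom B
  id A := ⟨𝟙 A.obj, IsEquivariant.id G A.action⟩
  comp f g := ⟨f.hom ≫ g.hom, IsEquivariant.comp G g.equivariant f.equivariant⟩

/-- The forgetful functor from unital C*-algebras with an action of `G` to unital C*-algebras. -/
def forgetAction : EquivariantCStarCat G ⥤ UnitalCStarCat.{u} where
  obj A := A.obj
  map f := f.hom

end Categories

end
end LCQG

namespace LCQG
noncomputable section
open Filter Topology

/-! ### Continuity, dense spans and additivity of elementary tensors -/

section Basic
variable {A B : Type u} [NonUnitalCStarAlgebra A] [NonUnitalCStarAlgebra B]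

/-! The underlying product of finitely many unital C*-algebras A_i is their direct sum P. It comes
with projections P → A_i and with non-unital inclusions A_i → P that are orthogonal and satisfy ∑
incl_i proj_i = id. These identities (`Decomp`) survive tensoring with a fixed C*-algebra C, so C ⊗
P is the direct sum of the C ⊗ A_i (`Decomp.tensor`). A family of multipliers of the summands of a
finite direct sum glues to a multiplier of the sum (`Decomp.mult`), and a multiplier is determined
by its components (`Decomp.mult_ext`).

Hence actions ρ_i on the A_i give a homomorphism P → M(C₀(G) ⊗ P) with components ρ_i ∘ proj_i, and
each axiom of an action can be checked in the summands. Algebraic identities hold because the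
projections are jointly injective. Density holds because each element is the finite sum of its
included components. Coassociativity also needs the identification of (C ⊗ C) ⊗ P with C ⊗ (C ⊗ P)
to be natural in P (`map_mem_assocGraph`).

The projections are equivariant by construction. Since they stay jointly injective after tensoring
with C₀(G), a unital homomorphism into P is equivariant once its components are
(`isEquivariant_piLift`), so P with this action is the product. Finally, the inverse of an
equivariant isomorphism is equivariant (`IsEquivariant.of_inverse`), so the forgetful functor
reflects isomorphisms. Together with the lift of the standard product cone, this gives creation of
products. -/

theorem Mult.continuous_fst_apply (x : A) : Continuous fun m : Mult A ↦ m.fst x :=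
  AddMonoidHomClass.continuous_of_bound
    (⟨⟨fun m ↦ m.fst x, rfl⟩, fun _ _ ↦ rfl⟩ : Mult A →+ A) ‖x‖ fun m ↦ by
      rw [mul_comm, ← DoubleCentralizer.norm_fst]
      exact m.fst.le_opNorm x

/-- A homomorphism of C*-algebras as a bounded linear map. -/
def homL (f : A →⋆ₙₐ[ℂ] B) : A →L[ℂ] B := ⟨LinearMapClass.linearMap f, continuous_hom f⟩

theorem homL_apply (f : A →⋆ₙₐ[ℂ] B) (a : A) : homL f a = f a := rfl

/-- A bounded linear map sends the closed span of a set into any closed subspace that contains the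
images of the elements of the set. -/
theorem map_mem_of_span_dense {V W : Type*} [NormedAddCommGroup V] [NormedSpace ℂ V]
    [NormedAddCommGroup W] [NormedSpace ℂ W] (T : V →L[ℂ] W) {s : Set V} {K : Submodule ℂ W}
    (hK : IsClosed (K : Set W)) (h : ∀ v ∈ s, T v ∈ K) {v : V}
    (hv : v ∈ (Submodule.span ℂ s).topologicalClosure) : T v ∈ K :=
  (Submodule.topologicalClosure_minimal (t := K.comap T.toLinearMap) _ (Submodule.span_le.2 h)
    (hK.preimage T.continuous)) hv

theorem tmul_add {a : A} {b b' : B} : tmul a (b + b') = tmul a b + tmul a b' := by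
  simp only [tmul, ← map_add]
  exact congrArg ofAlg (TensorProduct.tmul_add a b b')

theorem tmul_zero {a : A} : tmul a (0 : B) = 0 := by
  simpa using tmul_add (a := a) (b := (0 : B)) (b' := 0)

theorem tmul_sum {ι : Type*} {s : Finset ι} {a : A} {b : ι → B} :
    tmul a (∑ i ∈ s, b i) = ∑ i ∈ s, tmul a (b i) :=
  map_sum (⟨⟨fun b ↦ tmul a b, tmul_zero⟩, fun _ _ ↦ tmul_add⟩ : B →+ A ⊗ₘ B) b s

end Basic

/-! ### Functoriality of the spatial tensor product and naturality of its multipliers -/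

section Naturality
variable {A B A' B' A₁ B₁ A₁' B₁' : Type u} [NonUnitalCStarAlgebra A] [NonUnitalCStarAlgebra B]
  [NonUnitalCStarAlgebra A'] [NonUnitalCStarAlgebra B'] [NonUnitalCStarAlgebra A₁]
  [NonUnitalCStarAlgebra B₁] [NonUnitalCStarAlgebra A₁'] [NonUnitalCStarAlgebra B₁']

/-- Both sides are homomorphisms that agree on elementary tensors. This functoriality carries
composition identities of projections, inclusions and mutually inverse maps over to the tensor
product. -/
theorem SpatialTensor.map_comp_apply (f : A →⋆ₙₐ[ℂ] A') (g : B →⋆ₙₐ[ℂ] B') (f' : A' →⋆ₙₐ[ℂ] A₁)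
    (g' : B' →⋆ₙₐ[ℂ] B₁) (x : A ⊗ₘ B) :
    SpatialTensor.map f' g' (SpatialTensor.map f g x) =
      SpatialTensor.map (f'.comp f) (g'.comp g) x := by
  have h : (SpatialTensor.map f' g').comp (SpatialTensor.map f g) =
      SpatialTensor.map (f'.comp f) (g'.comp g) := SpatialTensor.hom_ext fun a b ↦ by
    rw [NonUnitalStarAlgHom.comp_apply]
    simp only [SpatialTensor.map_tmul]
    rfl
  exact DFunLike.congr_fun h x

theorem SpatialTensor.map_id_apply (x : A ⊗ₘ B) :
    SpatialTensor.map (.id ℂ A) (.id ℂ B) x = x := by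
  have h : SpatialTensor.map (.id ℂ A) (.id ℂ B) = .id ℂ (A ⊗ₘ B) :=
    SpatialTensor.hom_ext fun a b ↦ SpatialTensor.map_tmul ..
  exact DFunLike.congr_fun h x

/-- Homomorphisms that intertwine `f`, `f₁` and `g`, `g₁` also intertwine `f ⊗ g` and `f₁ ⊗ g₁`. -/
theorem map_tensorHom {f : A →⋆ₙₐ[ℂ] Mult A'} {g : B →⋆ₙₐ[ℂ] Mult B'} {f₁ : A₁ →⋆ₙₐ[ℂ] Mult A₁'}
    {g₁ : B₁ →⋆ₙₐ[ℂ] Mult B₁'} (u : A →⋆ₙₐ[ℂ] A₁) (u' : A' →⋆ₙₐ[ℂ] A₁') (v : B →⋆ₙₐ[ℂ] B₁)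
    (v' : B' →⋆ₙₐ[ℂ] B₁') (hu : ∀ a x, u' ((f a).fst x) = (f₁ (u a)).fst (u' x))
    (hv : ∀ b y, v' ((g b).fst y) = (g₁ (v b)).fst (v' y)) (z : A ⊗ₘ B) (x : A' ⊗ₘ B') :
    SpatialTensor.map u' v' ((tensorHom f g z).fst x) =
      (tensorHom f₁ g₁ (SpatialTensor.map u v z)).fst (SpatialTensor.map u' v' x) := by
  -- Both sides are additive and continuous in `z` and in `x`, so elementary tensors suffice.
  -- Closedness in `z` uses that evaluating a multiplier at a fixed element is norm continuous.
  induction z using SpatialTensor.induction with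
  | hc =>
    exact isClosed_eq
      ((continuous_hom _).comp ((Mult.continuous_fst_apply x).comp (continuous_hom _)))
      ((Mult.continuous_fst_apply _).comp ((continuous_hom _).comp (continuous_hom _)))
  | h0 => simp only [map_zero]; exact map_zero _
  | ha z z' h h' =>
    simp only [map_add, DoubleCentralizer.add_fst, add_apply, h, h']
  | ht a b =>
    induction x using SpatialTensor.induction with
    | hc =>
      exact isClosed_eq ((continuous_hom _).comp (ContinuousLinearMap.continuous _))
        ((ContinuousLinearMap.continuous _).comp (continuous_hom _))
    | h0 => simp only [map_zero]
    | ha x x' h h' => simp only [map_add, h, h']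
    | ht a' b' => simp only [tensorHom_tmul, SpatialTensor.map_tmul, hu, hv]

/-- The multiplier c ⊗ 1 acts on the first leg only and id ⊗ v on the second only. The units are
those of M(B) and M(B'), so `v` can be any homomorphism. -/
theorem map_tmulOne {C : Type u} [NonUnitalCStarAlgebra C] (v : B →⋆ₙₐ[ℂ] B') (c : C)
    (x : C ⊗ₘ B) : SpatialTensor.map (.id ℂ C) v ((tmulOne B c).fst x) =
      (tmulOne B' c).fst (SpatialTensor.map (.id ℂ C) v x) := by
  induction x using SpatialTensor.induction with
  | hc =>
    exact isClosed_eq ((continuous_hom _).comp (ContinuousLinearMap.continuous _))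
      ((ContinuousLinearMap.continuous _).comp (continuous_hom _))
  | h0 => simp only [map_zero]
  | ha x x' h h' => simp only [map_add, h, h']
  | ht a b =>
    rw [tmulOne, multTensor_tmul, SpatialTensor.map_tmul, SpatialTensor.map_tmul, tmulOne,
      multTensor_tmul]
    rfl

/-- The graph is the closed span of the pairs of rebracketed elementary tensors, and the bounded map
given by `f` on the last leg of both entries sends such pairs to such pairs. It is applied to
projections and to inclusions. -/
theorem map_mem_assocGraph {C C' : Type u} [NonUnitalCStarAlgebra C] [NonUnitalCStarAlgebra C']
    (f : C →⋆ₙₐ[ℂ] C') {p : ((A ⊗ₘ B) ⊗ₘ C) × (A ⊗ₘ (B ⊗ₘ C))} (hp : p ∈ assocGraph A B C) :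
    (SpatialTensor.map (.id ℂ _) f p.1,
      SpatialTensor.map (.id ℂ _) (SpatialTensor.map (.id ℂ _) f) p.2) ∈ assocGraph A B C' := by
  refine map_mem_of_span_dense ((homL (SpatialTensor.map (.id ℂ _) f)).prodMap
    (homL (SpatialTensor.map (.id ℂ _) (SpatialTensor.map (.id ℂ _) f))))
    (Submodule.isClosed_topologicalClosure _) ?_ hp
  rintro _ ⟨a, b, c, rfl⟩
  refine Submodule.le_topologicalClosure _ (Submodule.subset_span ⟨a, b, f c, ?_⟩)
  refine Prod.ext ?_ ?_
  · exact SpatialTensor.map_tmul ..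
  · exact (SpatialTensor.map_tmul ..).trans (congrArg (tmul a) (SpatialTensor.map_tmul ..))

end Naturality

/-! ### Finite direct sums of C*-algebras, their multipliers and their tensor products -/

/-- A decomposition of the C*-algebra `D` as the direct sum of the C*-algebras `E i`. -/
structure Decomp {ι : Type} [Fintype ι] (D : Type u) [NonUnitalCStarAlgebra D] (E : ι → Type u)
    [∀ i, NonUnitalCStarAlgebra (E i)] where
  proj : ∀ i, D →⋆ₙₐ[ℂ] E i
  incl : ∀ i, E i →⋆ₙₐ[ℂ] D
  proj_incl_self : ∀ i x, proj i (incl i x) = x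
  proj_incl_ne : ∀ i j x, i ≠ j → proj i (incl j x) = 0
  sum_incl_proj : ∀ x, ∑ i, incl i (proj i x) = x

namespace Decomp
variable {ι : Type} [Fintype ι]

section General
variable {D : Type u} [NonUnitalCStarAlgebra D] {E : ι → Type u}
  [∀ i, NonUnitalCStarAlgebra (E i)] (d : Decomp D E)

include d in
-- An element is recovered from its components by `sum_incl_proj`. This is the device that reduces
-- identities in `D` to the summands.
theorem ext_proj {x y : D} (h : ∀ i, d.proj i x = d.proj i y) : x = y := by
  rw [← d.sum_incl_proj x, ← d.sum_incl_proj y]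
  simp only [h]

theorem proj_sum_incl (y : ∀ i, E i) (i : ι) : d.proj i (∑ j, d.incl j (y j)) = y i := by
  rw [map_sum, Finset.sum_eq_single i (fun j _ h ↦ d.proj_incl_ne i j _ h.symm)
    (fun h ↦ absurd (Finset.mem_univ i) h), d.proj_incl_self]

/-- The multiplier of `D` with the given components. -/
def mult (m : ∀ i, Mult (E i)) : Mult D where
  fst := ∑ i, (homL (d.incl i)).comp ((m i).fst.comp (homL (d.proj i)))
  snd := ∑ i, (homL (d.incl i)).comp ((m i).snd.comp (homL (d.proj i)))
  central x y := d.ext_proj fun i ↦ by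
    simp only [sum_apply, ContinuousLinearMap.comp_apply, homL_apply, map_mul,
      d.proj_sum_incl]
    exact (m i).central _ _

theorem proj_mult_fst (m : ∀ i, Mult (E i)) (i : ι) (x : D) :
    d.proj i ((d.mult m).fst x) = (m i).fst (d.proj i x) := by
  simp only [mult, sum_apply, ContinuousLinearMap.comp_apply, homL_apply,
    d.proj_sum_incl]

theorem proj_mult_snd (m : ∀ i, Mult (E i)) (i : ι) (x : D) :
    d.proj i ((d.mult m).snd x) = (m i).snd (d.proj i x) := by
  simp only [mult, sum_apply, ContinuousLinearMap.comp_apply, homL_apply,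
    d.proj_sum_incl]

include d in
theorem mult_ext {m n : Mult D} (h : ∀ i x, d.proj i (m.fst x) = d.proj i (n.fst x)) : m = n :=
  Mult.ext_fst fun x ↦ d.ext_proj fun i ↦ h i x

/-- A glued multiplier preserves each summand: in components, both sides are the action of `m i` at
`i` and zero elsewhere. -/
theorem mult_fst_incl (m : ∀ i, Mult (E i)) (i : ι) (y : E i) :
    (d.mult m).fst (d.incl i y) = d.incl i ((m i).fst y) := d.ext_proj fun j ↦ by
  rw [d.proj_mult_fst]
  by_cases h : j = i
  · subst h
    rw [d.proj_incl_self, d.proj_incl_self]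
  · rw [d.proj_incl_ne _ _ _ h, d.proj_incl_ne _ _ _ h, map_zero]

/-- The tensor product with a fixed C*-algebra of a direct sum decomposition. -/
def tensor (C : Type u) [NonUnitalCStarAlgebra C] : Decomp (C ⊗ₘ D) (fun i ↦ C ⊗ₘ E i) where
  proj i := SpatialTensor.map (.id ℂ C) (d.proj i)
  incl i := SpatialTensor.map (.id ℂ C) (d.incl i)
  proj_incl_self i x := by
    -- Here functoriality suffices, since the composite of the two homomorphisms is the identity of
    -- `E i`.
    rw [SpatialTensor.map_comp_apply]
    have h : (d.proj i).comp (d.incl i) = .id ℂ (E i) :=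
      NonUnitalStarAlgHom.ext (d.proj_incl_self i)
    rw [h]
    exact SpatialTensor.map_id_apply x
  proj_incl_ne i j x hij := by
    induction x using SpatialTensor.induction with
    | hc => exact isClosed_eq ((continuous_hom _).comp (continuous_hom _)) continuous_const
    | h0 => simp only [map_zero]
    | ha x x' h h' => simp only [map_add, h, h', add_zero]
    | ht a b =>
      rw [SpatialTensor.map_tmul, SpatialTensor.map_tmul, d.proj_incl_ne i j b hij, tmul_zero]
  sum_incl_proj x := by
    -- A sum of homomorphisms is not covered by the functoriality of `SpatialTensor.map`. The
    -- identity is checked on elementary tensors, by additivity in the second leg, and extended by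
    -- density.
    induction x using SpatialTensor.induction with
    | hc =>
      exact isClosed_eq (continuous_finsetSum _ fun i _ ↦
        (continuous_hom _).comp (continuous_hom _)) continuous_id
    | h0 => simp only [map_zero, Finset.sum_const_zero]
    | ha x x' h h' => simp only [map_add, Finset.sum_add_distrib, h, h']
    | ht a b =>
      simp only [SpatialTensor.map_tmul, ← tmul_sum, d.sum_incl_proj]
      rfl

end General

/-- The product of C*-algebras is their direct sum. -/
def pi (A : ι → Type u) [∀ i, CStarAlgebra (A i)] : Decomp (∀ i, A i) A :=
  open scoped Classical in
  { proj := fun i ↦ (Pi.evalStarAlgHom ℂ A i : (∀ i, A i) →⋆ₙₐ[ℂ] A i)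
    -- `Pi.single i` is multiplicative but in general not unital, which is why `Decomp` consists of
    -- non-unital homomorphisms.
    incl := fun i ↦
      { toFun := Pi.single i
        map_smul' := fun c x ↦ Pi.single_smul i c x
        map_zero' := Pi.single_zero i
        map_add' := Pi.single_add i
        map_mul' := Pi.single_mul i
        map_star' := fun x ↦ (Pi.single_star i x) }
    proj_incl_self := fun i x ↦ Pi.single_eq_same i x
    proj_incl_ne := fun _ _ x h ↦ Pi.single_eq_of_ne h x
    sum_incl_proj := fun x ↦ Finset.univ_sum_single x }

end Decomp

/-! ### The componentwise action on a direct sum -/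

section ProductAction
variable {G : LocallyCompactQuantumGroup.{u}} {ι : Type} [Fintype ι] {A : ι → Type u}
  {P : Type u} [NonUnitalCStarAlgebra P] [∀ i, NonUnitalCStarAlgebra (A i)]

/-- The coaction on a direct sum, given by coactions on the summands. -/
def Decomp.coaction (d : Decomp P A) (ρ : ∀ i, QAction G (A i)) :
    P →⋆ₙₐ[ℂ] Mult (G.alg ⊗ₘ P) where
  toFun a := (d.tensor G.alg).mult fun i ↦ (ρ i).ρ (d.proj i a)
  map_smul' c a := (d.tensor G.alg).mult_ext fun i x ↦ by
    rw [DoubleCentralizer.smul_fst, smul_apply, map_smul]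
    simp only [Decomp.proj_mult_fst, map_smul, MonoidHom.id_apply]
    rfl
  map_zero' := (d.tensor G.alg).mult_ext fun i x ↦ by
    simp only [Decomp.proj_mult_fst, map_zero]
    exact (map_zero _).symm
  map_add' a b := (d.tensor G.alg).mult_ext fun i x ↦ by
    rw [DoubleCentralizer.add_fst, add_apply, map_add]
    simp only [Decomp.proj_mult_fst, map_add]
    rfl
  map_mul' a b := (d.tensor G.alg).mult_ext fun i x ↦ by
    rw [DoubleCentralizer.mul_fst]
    simp only [Decomp.proj_mult_fst, map_mul, mul_apply_eq_comp]
    rfl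
  map_star' a := (d.tensor G.alg).mult_ext fun i x ↦ by
    -- The involution exchanges left and right actions, so the left action of the adjoint is
    -- computed from the components of the right action.
    rw [DoubleCentralizer.star_fst]
    simp only [Decomp.proj_mult_fst, Decomp.proj_mult_snd, map_star, DoubleCentralizer.star_fst]

variable (d : Decomp P A) (ρ : ∀ i, QAction G (A i))

/-- With its counterpart for `snd`, this is the equivariance of the projections; it holds by the
construction of `coaction`. -/
theorem Decomp.map_proj_coaction_fst (i : ι) (a : P) (x : G.alg ⊗ₘ P) :
    SpatialTensor.map (.id ℂ G.alg) (d.proj i) ((d.coaction ρ a).fst x) =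
      ((ρ i).ρ (d.proj i a)).fst (SpatialTensor.map (.id ℂ G.alg) (d.proj i) x) :=
  (d.tensor G.alg).proj_mult_fst _ i x

theorem Decomp.map_proj_coaction_snd (i : ι) (a : P) (x : G.alg ⊗ₘ P) :
    SpatialTensor.map (.id ℂ G.alg) (d.proj i) ((d.coaction ρ a).snd x) =
      ((ρ i).ρ (d.proj i a)).snd (SpatialTensor.map (.id ℂ G.alg) (d.proj i) x) :=
  (d.tensor G.alg).proj_mult_snd _ i x

/-- The inclusions intertwine the left actions. This places ρ_i(a)y, for each summand, among the
elements required for non-degeneracy of `coaction`. -/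
theorem Decomp.coaction_incl_fst (i : ι) (a : A i) (y : G.alg ⊗ₘ A i) :
    (d.coaction ρ (d.incl i a)).fst (SpatialTensor.map (.id ℂ G.alg) (d.incl i) y) =
      SpatialTensor.map (.id ℂ G.alg) (d.incl i) (((ρ i).ρ a).fst y) := by
  refine ((d.tensor G.alg).mult_fst_incl _ i y).trans ?_
  rw [d.proj_incl_self]
  rfl

/-- A set that contains the images of sets with dense span in all summands of `D` has dense span
in `D`. -/
theorem Decomp.closure_eq_top {D : Type u} [NonUnitalCStarAlgebra D] {E : ι → Type u}
    [∀ i, NonUnitalCStarAlgebra (E i)] (d : Decomp D E) {s : Set D} {t : ∀ i, Set (E i)}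
    (ht : ∀ i, (Submodule.span ℂ (t i)).topologicalClosure = ⊤)
    (h : ∀ i, ∀ y ∈ t i, d.incl i y ∈ s) : (Submodule.span ℂ s).topologicalClosure = ⊤ := by
  refine eq_top_iff.2 fun x _ ↦ ?_
  -- Each `x` is a finite sum of included components, and each component lies in the closed span of
  -- `t i`, which the bounded map `d.incl i` sends into the closed span of `s`.
  rw [← d.sum_incl_proj x]
  refine Submodule.sum_mem _ fun i _ ↦ ?_
  refine map_mem_of_span_dense (homL (d.incl i)) (Submodule.isClosed_topologicalClosure _)
    (fun y hy ↦ Submodule.le_topologicalClosure _ (Submodule.subset_span (h i y hy)))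
    (s := t i) ?_
  rw [ht]
  exact Submodule.mem_top

/-- The extension values of the summands are glued along the decompositions of (C ⊗ C) ⊗ P and of C
⊗ (C ⊗ P) induced by that of P. All conditions then reduce to coassociativity of the ρ_i. -/
theorem Decomp.coaction_coassoc (a : P) : ∃ m n,
    IsExtensionValue (tensorHom G.Δ toMult) (d.coaction ρ a) m ∧
    IsExtensionValue (tensorHom toMult (d.coaction ρ)) (d.coaction ρ a) n ∧ MultAssoc m n := by
  choose m n hm hn hmn using fun i ↦ (ρ i).coassoc (d.proj i a)
  let dl := d.tensor (G.alg ⊗ₘ G.alg)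
  let dr := (d.tensor G.alg).tensor G.alg
  -- Naturality of Δ ⊗ id in its second leg, and below of id ⊗ ρ, where the equivariance of the
  -- projections enters.
  have hl (i : ι) (z x) : dl.proj i ((tensorHom G.Δ toMult z).fst x) =
      (tensorHom G.Δ toMult ((d.tensor G.alg).proj i z)).fst (dl.proj i x) :=
    map_tensorHom _ _ _ _ (fun _ _ ↦ rfl) (fun b y ↦ map_mul (d.proj i) b y) z x
  have hr (i : ι) (z x) : dr.proj i ((tensorHom toMult (d.coaction ρ) z).fst x) =
      (tensorHom toMult (ρ i).ρ ((d.tensor G.alg).proj i z)).fst (dr.proj i x) :=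
    map_tensorHom _ _ _ _ (fun _ _ ↦ rfl) (fun b y ↦ d.map_proj_coaction_fst ρ i b y) z x
  refine ⟨dl.mult m, dr.mult n, fun z ↦ ⟨?_, ?_⟩, fun z ↦ ⟨?_, ?_⟩, fun p hp ↦ ?_⟩
  -- In component `i`, each of the four identities becomes the one for `m i` or `n i` at the
  -- projection of `z`.
  · refine dl.mult_ext fun i x ↦ ?_
    rw [DoubleCentralizer.mul_fst, mul_apply_eq_comp, dl.proj_mult_fst, hl, hl,
      ← mul_apply_eq_comp, ← DoubleCentralizer.mul_fst, (hm i _).1]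
    exact congrArg (fun w ↦ (tensorHom G.Δ toMult w).fst (dl.proj i x))
      (d.map_proj_coaction_fst ρ i a z).symm
  · refine dl.mult_ext fun i x ↦ ?_
    rw [DoubleCentralizer.mul_fst, mul_apply_eq_comp, hl, dl.proj_mult_fst, hl,
      ← mul_apply_eq_comp, ← DoubleCentralizer.mul_fst, (hm i _).2]
    exact congrArg (fun w ↦ (tensorHom G.Δ toMult w).fst (dl.proj i x))
      (d.map_proj_coaction_snd ρ i a z).symm
  · refine dr.mult_ext fun i x ↦ ?_
    rw [DoubleCentralizer.mul_fst, mul_apply_eq_comp, dr.proj_mult_fst, hr, hr,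
      ← mul_apply_eq_comp, ← DoubleCentralizer.mul_fst, (hn i _).1]
    exact congrArg (fun w ↦ (tensorHom toMult (ρ i).ρ w).fst (dr.proj i x))
      (d.map_proj_coaction_fst ρ i a z).symm
  · refine dr.mult_ext fun i x ↦ ?_
    rw [DoubleCentralizer.mul_fst, mul_apply_eq_comp, hr, dr.proj_mult_fst, hr,
      ← mul_apply_eq_comp, ← DoubleCentralizer.mul_fst, (hn i _).2]
    exact congrArg (fun w ↦ (tensorHom toMult (ρ i).ρ w).fst (dr.proj i x))
      (d.map_proj_coaction_snd ρ i a z).symm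
  -- The glued pair acts on `p` by projecting to a summand, acting there, including back and
  -- summing. Each of these operations preserves the associativity graphs.
  · have h : ((dl.mult m).fst p.1, (dr.mult n).fst p.2) =
        ∑ i, (dl.incl i ((m i).fst (dl.proj i p.1)), dr.incl i ((n i).fst (dr.proj i p.2))) := by
      refine Prod.ext ?_ ?_
      · rw [Prod.fst_sum]
        exact dl.ext_proj fun i ↦ by rw [dl.proj_mult_fst, dl.proj_sum_incl]
      · rw [Prod.snd_sum]
        exact dr.ext_proj fun i ↦ by rw [dr.proj_mult_fst, dr.proj_sum_incl]
    rw [h]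
    exact Submodule.sum_mem _ fun i _ ↦
      map_mem_assocGraph (d.incl i) (hmn i _ (map_mem_assocGraph (d.proj i) hp))

/-- The action on a direct sum, given by actions on the summands. -/
def Decomp.action : QAction G P where
  ρ := d.coaction ρ
  nondegenerate := (d.tensor G.alg).closure_eq_top (fun i ↦ (ρ i).nondegenerate) <| by
    rintro i _ ⟨a, y, rfl⟩
    exact ⟨_, _, (d.coaction_incl_fst ρ i a y).symm⟩
  coassoc := d.coaction_coassoc ρ
  relMult a c := by
    have key (i : ι) := (ρ i).relMult (d.proj i a) c
    choose y hy using fun i ↦ (key i).1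
    choose z hz using fun i ↦ (key i).2
    -- The witnesses are glued from those of the summands; the projections commute with c ⊗ 1 by
    -- `map_tmulOne`.
    refine ⟨⟨∑ i, (d.tensor G.alg).incl i (y i), (d.tensor G.alg).mult_ext fun i x ↦ ?_⟩,
      ⟨∑ i, (d.tensor G.alg).incl i (z i), (d.tensor G.alg).mult_ext fun i x ↦ ?_⟩⟩
    · refine (map_mul ((d.tensor G.alg).proj i) _ x).trans ?_
      rw [(d.tensor G.alg).proj_sum_incl]
      refine (congrArg (fun m : Mult (G.alg ⊗ₘ A i) ↦ m.fst ((d.tensor G.alg).proj i x))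
        (hy i)).trans ?_
      rw [DoubleCentralizer.mul_fst, DoubleCentralizer.mul_fst, mul_apply_eq_comp,
        mul_apply_eq_comp]
      refine Eq.trans ?_ (d.map_proj_coaction_fst ρ i a _).symm
      rw [map_tmulOne]
      rfl
    · refine (map_mul ((d.tensor G.alg).proj i) _ x).trans ?_
      rw [(d.tensor G.alg).proj_sum_incl]
      refine (congrArg (fun m : Mult (G.alg ⊗ₘ A i) ↦ m.fst ((d.tensor G.alg).proj i x))
        (hz i)).trans ?_
      rw [DoubleCentralizer.mul_fst, DoubleCentralizer.mul_fst, mul_apply_eq_comp,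
        mul_apply_eq_comp]
      refine Eq.trans ?_ (map_tmulOne (d.proj i) c _).symm
      rw [d.map_proj_coaction_fst]
      rfl
  dense := (d.tensor G.alg).closure_eq_top (fun i ↦ (ρ i).dense) <| by
    rintro i y ⟨a, c, h⟩
    -- The multiplier of `d.incl i a` has component ρ_i(a) at `i` and zero elsewhere, so its product
    -- with c ⊗ 1 is the included element `y`.
    refine ⟨d.incl i a, c, (d.tensor G.alg).mult_ext fun j x ↦ ?_⟩
    refine (map_mul ((d.tensor G.alg).proj j) _ x).trans ?_
    rw [DoubleCentralizer.mul_fst, mul_apply_eq_comp]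
    refine Eq.trans ?_ (d.map_proj_coaction_fst ρ j _ _).symm
    rw [map_tmulOne]
    by_cases hj : j = i
    · subst hj
      rw [(d.tensor G.alg).proj_incl_self, d.proj_incl_self]
      exact congrArg (fun m : Mult (G.alg ⊗ₘ A j) ↦ m.fst ((d.tensor G.alg).proj j x)) h
    · rw [(d.tensor G.alg).proj_incl_ne _ _ _ hj, d.proj_incl_ne _ _ _ hj, zero_mul, map_zero]
      rfl

end ProductAction

/-! ### Products of equivariant algebras and their creation -/

section Creation
open CategoryTheory CategoryTheory.Limits
variable {G : LocallyCompactQuantumGroup.{u}}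

/-- By functoriality id ⊗ f and id ⊗ g are mutually inverse. Equivariance of `f` at `g b` and (id ⊗
g)(y), followed by id ⊗ g, is equivariance of `g`. -/
theorem IsEquivariant.of_inverse {A B : Type u} [CStarAlgebra A] [CStarAlgebra B]
    {ρA : QAction G A} {ρB : QAction G B} {f : A →⋆ₐ[ℂ] B} {g : B →⋆ₐ[ℂ] A}
    (hf : IsEquivariant ρA ρB f) (hgf : ∀ a, g (f a) = a) (hfg : ∀ b, f (g b) = b) :
    IsEquivariant ρB ρA g := by
  rw [isEquivariant_iff] at hf ⊢
  have h1 (x) : SpatialTensor.map (.id ℂ G.alg) (g : B →⋆ₙₐ[ℂ] A)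
      (SpatialTensor.map (.id ℂ G.alg) (f : A →⋆ₙₐ[ℂ] B) x) = x := by
    rw [SpatialTensor.map_comp_apply]
    have h : (g : B →⋆ₙₐ[ℂ] A).comp (f : A →⋆ₙₐ[ℂ] B) = .id ℂ A := NonUnitalStarAlgHom.ext hgf
    rw [h]
    exact SpatialTensor.map_id_apply x
  have h2 (x) : SpatialTensor.map (.id ℂ G.alg) (f : A →⋆ₙₐ[ℂ] B)
      (SpatialTensor.map (.id ℂ G.alg) (g : B →⋆ₙₐ[ℂ] A) x) = x := by
    rw [SpatialTensor.map_comp_apply]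
    have h : (f : A →⋆ₙₐ[ℂ] B).comp (g : B →⋆ₙₐ[ℂ] A) = .id ℂ B := NonUnitalStarAlgHom.ext hfg
    rw [h]
    exact SpatialTensor.map_id_apply x
  intro b y
  have h := hf (g b) (SpatialTensor.map (.id ℂ G.alg) (g : B →⋆ₙₐ[ℂ] A) y)
  rw [h2, hfg] at h
  rw [h.1, h.2, h1, h1]
  exact ⟨rfl, rfl⟩

/-- The inverse of the underlying map is equivariant by `IsEquivariant.of_inverse`. This is what
makes the lift of a product cone unique up to isomorphism. -/
instance : (forgetAction G).ReflectsIsomorphisms where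
  reflects {A B} f hf := by
    obtain ⟨g, h1, h2⟩ := hf
    refine ⟨⟨g, IsEquivariant.of_inverse f.equivariant (fun a ↦ ?_) (fun b ↦ ?_)⟩,
      EquivariantCStarCat.Hom.ext h1, EquivariantCStarCat.Hom.ext h2⟩
    · exact DFunLike.congr_fun (F := A.obj.carrier →⋆ₐ[ℂ] A.obj.carrier) h1 a
    · exact DFunLike.congr_fun (F := B.obj.carrier →⋆ₐ[ℂ] B.obj.carrier) h2 b

variable {ι : Type} [Fintype ι]

/-- The product of a finite family of unital C*-algebras with an action of `G`. -/
def EquivariantCStarCat.pi (A : ι → EquivariantCStarCat G) : EquivariantCStarCat G where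
  obj := ⟨∀ i, (A i).obj.carrier⟩
  action := (Decomp.pi fun i ↦ (A i).obj.carrier).action fun i ↦ (A i).action

/-- The projections of the product. -/
def EquivariantCStarCat.piProj (A : ι → EquivariantCStarCat G) (i : ι) : pi A ⟶ A i where
  hom := Pi.evalStarAlgHom ℂ (fun i ↦ (A i).obj.carrier) i
  equivariant := (isEquivariant_iff G).2 fun a x ↦
    ⟨((Decomp.pi fun i ↦ (A i).obj.carrier).map_proj_coaction_fst (fun i ↦ (A i).action) i a x).symm,
      ((Decomp.pi fun i ↦ (A i).obj.carrier).map_proj_coaction_snd (fun i ↦ (A i).action) i a x).symm⟩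

/-- The unital homomorphism into a product with the given components. -/
def piLift {B : Type u} [CStarAlgebra B] {A : ι → Type u} [∀ i, CStarAlgebra (A i)]
    (f : ∀ i, B →⋆ₐ[ℂ] A i) : B →⋆ₐ[ℂ] (∀ i, A i) where
  toAlgHom := AlgHom.pi fun i ↦ (f i).toAlgHom
  map_star' b := funext fun i ↦ map_star (f i) b

/-- The projections of C₀(G) ⊗ ∏ A_i are jointly injective and equivariant, so it suffices that each
component `f i` is equivariant. -/
theorem isEquivariant_piLift (A : ι → EquivariantCStarCat G) {B : EquivariantCStarCat G}
    (f : ∀ i, B ⟶ A i) : IsEquivariant B.action (EquivariantCStarCat.pi A).action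
      (piLift fun i ↦ (f i).hom) := by
  let d := Decomp.pi fun i ↦ (A i).obj.carrier
  let φ (i : ι) : B.obj.carrier →⋆ₐ[ℂ] (A i).obj.carrier := (f i).hom
  let F := SpatialTensor.map (.id ℂ G.alg)
    (piLift φ : B.obj.carrier →⋆ₙₐ[ℂ] ∀ i, (A i).obj.carrier)
  -- The `i`-th projection of `piLift φ` is `φ i`, and tensoring with `G.alg` is functorial.
  have hF (i : ι) (x) : (d.tensor G.alg).proj i (F x) =
      SpatialTensor.map (.id ℂ G.alg) (φ i : B.obj.carrier →⋆ₙₐ[ℂ] (A i).obj.carrier) x :=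
    SpatialTensor.map_comp_apply ..
  refine (isEquivariant_iff G).2 fun b x ↦
    ⟨(d.tensor G.alg).ext_proj fun i ↦ ?_, (d.tensor G.alg).ext_proj fun i ↦ ?_⟩
  · refine (d.map_proj_coaction_fst (fun i ↦ (A i).action) i _ (F x)).trans ?_
    refine Eq.trans ?_ (hF i _).symm
    refine (congrArg _ (hF i x)).trans ?_
    exact ((isEquivariant_iff G).1 (f i).equivariant b x).1
  · refine (d.map_proj_coaction_snd (fun i ↦ (A i).action) i _ (F x)).trans ?_
    refine Eq.trans ?_ (hF i _).symm
    refine (congrArg _ (hF i x)).trans ?_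
    exact ((isEquivariant_iff G).1 (f i).equivariant b x).2

/-- The product cone in the category of C*-algebras with an action of `G`. -/
def piCone (K : Discrete ι ⥤ EquivariantCStarCat G) : Cone K where
  pt := EquivariantCStarCat.pi fun i ↦ K.obj ⟨i⟩
  π := Discrete.natTrans fun j ↦ EquivariantCStarCat.piProj (fun i ↦ K.obj ⟨i⟩) j.as

/-- `piCone` is a limit. -/
def isLimitPiCone (K : Discrete ι ⥤ EquivariantCStarCat G) : IsLimit (piCone K) where
  lift s := ⟨piLift fun i ↦ (s.π.app ⟨i⟩).hom, isEquivariant_piLift _ fun i ↦ s.π.app ⟨i⟩⟩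
  fac s j := EquivariantCStarCat.Hom.ext (by rfl)
  uniq s m hm := EquivariantCStarCat.Hom.ext <|
    StarAlgHom.ext (A := s.pt.obj.carrier) (B := ∀ i, (K.obj ⟨i⟩).obj.carrier) fun b ↦
      funext fun i ↦ DFunLike.congr_fun (F := s.pt.obj.carrier →⋆ₐ[ℂ] (K.obj ⟨i⟩).obj.carrier)
        (congrArg EquivariantCStarCat.Hom.hom (hm ⟨i⟩)) b

/-- The underlying cone of `piCone` is a limit. -/
def isLimitForgetPiCone (K : Discrete ι ⥤ EquivariantCStarCat G) :
    IsLimit ((forgetAction G).mapCone (piCone K)) where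
  lift s := piLift (B := s.pt.carrier) (A := fun i ↦ (K.obj ⟨i⟩).obj.carrier) fun i ↦ s.π.app ⟨i⟩
  fac s j := by rfl
  uniq s m hm :=
    StarAlgHom.ext (A := s.pt.carrier) (B := ∀ i, (K.obj ⟨i⟩).obj.carrier) fun b ↦
      funext fun i ↦ DFunLike.congr_fun (F := s.pt.carrier →⋆ₐ[ℂ] (K.obj ⟨i⟩).obj.carrier)
        (hm ⟨i⟩) b

end Creation

end
end LCQG

/-- Because isomorphisms are reflected, it is enough to lift each limit cone to a limit cone. Any
product cone `c` of the underlying algebras is isomorphic to the image of `piCone K`, both being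
limits. The index type may be empty, in which case the product is the zero algebra. -/
theorem mainTheorem12 (G : LCQG.LocallyCompactQuantumGroup.{u}) :
    Nonempty (CategoryTheory.Limits.CreatesFiniteProducts (LCQG.forgetAction G)) := by
  refine ⟨⟨fun J _ ↦ ⟨fun {K} ↦ CategoryTheory.createsLimitOfReflectsIso fun c t ↦ ?_⟩⟩⟩
  exact
    { liftedCone := LCQG.piCone K
      validLift := (LCQG.isLimitForgetPiCone K).uniqueUpToIso t
      makesLimit := LCQG.isLimitPiCone K }
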